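/- Let $n\ge 3$ and $k\ge 1$ be integers with $n\ge 2k$, put $m=\frac{n-2k}{n+2k}$, and let $\theta,\rho\in\mathbb R$ satisfy $\theta>0$ and $2\theta+\rho>0$. Let $\alpha>0$ and let $u=u_\alpha:\mathbb R^n\to(0,\infty)$ be a smooth, radially symmetric, admissible solution, with $u_\alpha(0)=\alpha$, of the $k$-Yamabe gradient soliton equation $$\sigma_k^{1/k}\Big(D^2v-\frac{|Dv|^2}{2v}\,I\Big)=u^{\frac{2k}{n+2k}-1}\Big[(2\theta+\rho)\,u+\frac{4k\theta}{n+2k}\,x\cdot Du\Big]\quad\text{on }\mathbb R^n,\qquad v=u^{-\frac{2k}{n+2k}}.$$ Here $\sigma_j$ of a matrix is the $j$-th elementary symmetric function of its eigenvalues, and $u$ is admissible if the metric $g=u^{\frac{4k}{n+2k}}|dx|^2$ lies in the positive cone $\Gamma_k^+$, that is, $\sigma_j(g^{-1}A_g)>0$ everywhere for $1\le j\le k$, where $A_g=\frac1{n-2}\big(\mathrm{Ric}_g-\frac{R_g}{2(n-1)}g\big)$ is the Schouten tensor. Write $f\asymp h$ if $C^{-1}h\le f\le Ch$ for some constant $C>0$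 and all sufficiently large $|x|$. Then, as $|x|\to\infty$: 1. (Expanders) If $\rho<0$, then $u_\alpha(x)=O\big(|x|^{-\frac{2}{1-m}-\delta}\big)$ with $\delta=\frac{\rho}{\theta(1-m)}$. 2. (Steady solitons) Let $\rho=0$. - If $n>2k$, then $u_\alpha(x)=O\Big(\big[\frac{\ln|x|}{|x|^2}\big]^{\frac1{1-m}}\Big)$. - If $n=2k$, then $u_\alpha(x)=O\Big(\frac{(\ln|x|)^{1-\frac2n}}{|x|^2}\Big)$. 3. (Shrinkers) Let $\rho>0$. - If $n>2k$ and $\rho\le 2\theta$, then $u_\alpha$ has slow decay: $u_\alpha(x)\asymp|x|^{-\frac{2}{1-m}}$. - If $n>2k$ and $\rho>2\theta$, then either $u_\alpha$ has slow decay, $u_\alpha(x)\asymp|x|^{-\frac{2}{1-m}}$, or it has fast decay, $u_\alpha(x)\asymp|x|^{-\frac{4}{1-m}}$. - If $n=2k$, then $u_\alpha(x)\asymp|x|^{-2(1+d)}$ for some $d$ with $0<d\le\min\{\frac{\rho}{2\theta},1\}$. -/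

import Mathlib

open Filter Asymptotics
open scoped ContDiff

namespace KYamabe

/-- The partial derivative `∂ᵢ f` of a function on `ℝⁿ`. -/
noncomputable def partialDeriv {n : ℕ} (i : Fin n) (f : EuclideanSpace ℝ (Fin n) → ℝ)
    (x : EuclideanSpace ℝ (Fin n)) : ℝ :=
  fderiv ℝ f x (EuclideanSpace.single i 1)

/-- The Hessian matrix `D² f`. -/
noncomputable def hessian {n : ℕ} (f : EuclideanSpace ℝ (Fin n) → ℝ)
    (x : EuclideanSpace ℝ (Fin n)) : Matrix (Fin n) (Fin n) ℝ :=
  Matrix.of fun i j => partialDeriv i (partialDeriv j f) x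

/-- The `j`-th elementary symmetric function of the (real) eigenvalues of a square matrix,
counted with multiplicity. It is only applied to matrices that are symmetric for smooth data. -/
noncomputable def sigma {n : ℕ} (j : ℕ) (A : Matrix (Fin n) (Fin n) ℝ) : ℝ :=
  A.charpoly.roots.esymm j

/-! ### Curvature of a metric on `ℝⁿ`, in the standard global coordinates

A metric is given by its coefficient matrix `g x = (g_{ij}(x))`. -/

/-- The Christoffel symbol
`Γᵃ_{ij} = ½ ∑ₗ g^{al} (∂ᵢ g_{jl} + ∂ⱼ g_{il} - ∂ₗ g_{ij})`. -/
noncomputable def christoffel {n : ℕ} (g : EuclideanSpace ℝ (Fin n) → Matrix (Fin n) (Fin n) ℝ)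
    (a i j : Fin n) (x : EuclideanSpace ℝ (Fin n)) : ℝ :=
  (1 / 2) * ∑ l, (g x)⁻¹ a l *
    (partialDeriv i (fun y => g y j l) x + partialDeriv j (fun y => g y i l) x
      - partialDeriv l (fun y => g y i j) x)

/-- The Ricci tensor
`R_{ij} = ∂ₐ Γᵃ_{ij} - ∂ⱼ Γᵃ_{ia} + Γᵃ_{al} Γˡ_{ij} - Γᵃ_{jl} Γˡ_{ia}`
(repeated indices `a`, `l` are summed). -/
noncomputable def ricci {n : ℕ} (g : EuclideanSpace ℝ (Fin n) → Matrix (Fin n) (Fin n) ℝ)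
    (x : EuclideanSpace ℝ (Fin n)) : Matrix (Fin n) (Fin n) ℝ :=
  Matrix.of fun i j =>
    ∑ a, (partialDeriv a (christoffel g a i j) x - partialDeriv j (christoffel g a i a) x
      + ∑ l, (christoffel g a a l x * christoffel g l i j x
          - christoffel g a j l x * christoffel g l i a x))

/-- The scalar curvature `R = g^{ij} R_{ij}`. -/
noncomputable def scalarCurvature {n : ℕ}
    (g : EuclideanSpace ℝ (Fin n) → Matrix (Fin n) (Fin n) ℝ)
    (x : EuclideanSpace ℝ (Fin n)) : ℝ :=
  ∑ i, ∑ j, (g x)⁻¹ i j * ricci g x i j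

/-- The Schouten tensor `A_g = (Ric_g - R_g / (2 (n - 1)) g) / (n - 2)`, for `n ≥ 3`. -/
noncomputable def schouten {n : ℕ} (g : EuclideanSpace ℝ (Fin n) → Matrix (Fin n) (Fin n) ℝ)
    (x : EuclideanSpace ℝ (Fin n)) : Matrix (Fin n) (Fin n) ℝ :=
  (1 / ((n : ℝ) - 2)) • (ricci g x - (scalarCurvature g x / (2 * ((n : ℝ) - 1))) • g x)

/-- `σⱼ(g)`: the `j`-th elementary symmetric function of the eigenvalues of the
`(1,1)`-tensor `g⁻¹ A_g`. -/
noncomputable def sigmaCurvature {n : ℕ} (j : ℕ)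
    (g : EuclideanSpace ℝ (Fin n) → Matrix (Fin n) (Fin n) ℝ)
    (x : EuclideanSpace ℝ (Fin n)) : ℝ :=
  sigma j ((g x)⁻¹ * schouten g x)

/-- The metric `g` lies in the positive cone `Γₖ⁺`: `σ₁(g), …, σₖ(g) > 0` at every point. -/
def InPositiveCone {n : ℕ} (k : ℕ)
    (g : EuclideanSpace ℝ (Fin n) → Matrix (Fin n) (Fin n) ℝ) : Prop :=
  ∀ x, ∀ j, 1 ≤ j → j ≤ k → 0 < sigmaCurvature j g x

/-- The conformally flat metric `g_u = u^{4k/(n+2k)} |dx|²`. -/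
noncomputable def conformalMetric {n : ℕ} (k : ℕ) (u : EuclideanSpace ℝ (Fin n) → ℝ)
    (x : EuclideanSpace ℝ (Fin n)) : Matrix (Fin n) (Fin n) ℝ :=
  (u x ^ (4 * k / (n + 2 * k) : ℝ)) • (1 : Matrix (Fin n) (Fin n) ℝ)

/-- The soliton equation at every point, with `v = u^{-2k/(n+2k)}`:
`σₖ^{1/k}(D²v - |Dv|²/(2v) I) = u^{2k/(n+2k) - 1} [(2θ+ρ) u + (4kθ/(n+2k)) x·Du]`. -/
def SolvesSolitonEquation {n : ℕ} (k : ℕ) (θ ρ : ℝ)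
    (u : EuclideanSpace ℝ (Fin n) → ℝ) : Prop :=
  let v : EuclideanSpace ℝ (Fin n) → ℝ := fun x => u x ^ (-(2 * k / (n + 2 * k)) : ℝ)
  ∀ x, sigma k (hessian v x - (‖gradient v x‖ ^ 2 / (2 * v x)) • (1 : Matrix (Fin n) (Fin n) ℝ))
        ^ (1 / k : ℝ)
      = u x ^ (2 * k / (n + 2 * k) - 1 : ℝ) *
        ((2 * θ + ρ) * u x + 4 * k * θ / (n + 2 * k) * inner ℝ x (gradient u x))

/-- `u` is a smooth, positive, radially symmetric, admissible solution of the soliton equation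
on `ℝⁿ`. -/
structure IsRadialSoliton {n : ℕ} (k : ℕ) (θ ρ : ℝ)
    (u : EuclideanSpace ℝ (Fin n) → ℝ) : Prop where
  smooth : ContDiff ℝ ∞ u
  pos : ∀ x, 0 < u x
  radial : ∀ x y, ‖x‖ = ‖y‖ → u x = u y
  admissible : InPositiveCone k (conformalMetric k u)
  equation : SolvesSolitonEquation k θ ρ u

end KYamabe

/-! Put `t = log r`, `ψ = (2k/(n+2k)) log u`, `y = ψ + t` and `q = y'`. The metric is `e^{2ψ}|dx|²`;
on a coordinate axis its Schouten tensor is diagonal with `n-1` equal entries, so the soliton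
equation becomes the autonomous ODE `a^(k-1) (((n-2k)/k) a - q') = D e^{2ky} (ρ+2θq)^k` with `a =
(1-q²)/2`. Positivity of `σ₁` gives `q < 1`, positivity of `σₖ` gives `ρ+2θq > 0`, and smoothness at
the origin gives `y → -∞`, `q → 1` as `t → -∞`. Since `u = exp((y-t)·2/(1-m))`, decay of `u` is a
question about the growth of `y`.

For `ρ ≤ 0` the right side acts as damping (`deriv_le`). If `ρ < 0`, then `q` stays above `-ρ/(2θ) >
0`, the factor `e^{2ky}` grows exponentially, and `q` is driven to `-ρ/(2θ)` at an integrable rate.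
If `ρ = 0`, the damping bounds `e^{2y} q`, half the derivative of `e^{2y}`; when `n = 2k` nothing
opposes it and a Young inequality improves the bound.

For `ρ > 0` the Pohozaev energy is nondecreasing and starts from `0` at `t = -∞`, so it is positive.
This keeps `q > -1`. If `n > 2k` it also bounds `y` on both sides, so decay is slow for every `ρ >
0`. If `n = 2k`, `q` decreases to some `-d < 0`, exponentially fast, and `y + dt` stays bounded. -/

namespace KYamabe

/-! ### Barrier and monotonicity principles -/

/-- A differentiable function on `[t₀, ∞)` starting below `K` stays below `K` if its derivative is
negative whenever it takes the value `K`. -/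
theorem le_of_deriv_neg_at_level {f f' : ℝ → ℝ} {t₀ K : ℝ} (hf : ∀ t, HasDerivAt f (f' t) t)
    (h0 : f t₀ ≤ K) (hK : ∀ t, t₀ ≤ t → f t = K → f' t < 0) : ∀ t, t₀ ≤ t → f t ≤ K := by
  intro t ht
  refine image_le_of_deriv_right_lt_deriv_boundary (f := f) (f' := f') (a := t₀) (b := t)
    (B := fun _ => K) (B' := fun _ => 0) ?_ ?_ h0 (fun x => hasDerivAt_const x K) ?_ ⟨ht, le_rfl⟩
  · exact fun x _ => (hf x).continuousAt.continuousWithinAt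
  · exact fun x _ => (hf x).hasDerivWithinAt
  · exact fun x hx h => hK x hx.1 h

theorem le_of_deriv_nonpos {f f' : ℝ → ℝ} {t₀ : ℝ} (hf : ∀ t, HasDerivAt f (f' t) t)
    (h : ∀ t, t₀ ≤ t → f' t ≤ 0) : ∀ t, t₀ ≤ t → f t ≤ f t₀ := by
  intro t ht
  have := antitoneOn_of_deriv_nonpos (f := f) (convex_Ici t₀)
    (fun x _ => (hf x).continuousAt.continuousWithinAt)
    (fun x _ => (hf x).differentiableAt.differentiableWithinAt)
    (fun x hx => by rw [(hf x).deriv]; exact h x (interior_subset hx))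
  exact this (Set.mem_Ici.2 le_rfl) (Set.mem_Ici.2 ht) ht

/-! ### The cylindrical ODE: expanders and steady solitons -/

/-- The radial soliton equation in the cylindrical variable `t = log r`. Here
`e^y = r u^{(1-m)/2}` and `q = y'`. -/
structure CylindricalSoliton (n k : ℕ) (θ ρ D : ℝ) (y q q' : ℝ → ℝ) : Prop where
  hk : 1 ≤ k
  hnk : 2 * k ≤ n
  hθ : 0 < θ
  hD : 0 < D
  deriv_y : ∀ t, HasDerivAt y (q t) t
  deriv_q : ∀ t, HasDerivAt q (q' t) t
  pos : ∀ t, 0 < ρ + 2 * θ * q t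
  lt_one : ∀ t, q t < 1
  eqn : ∀ t, ((1 - q t ^ 2) / 2) ^ (k - 1) *
    (((n : ℝ) - 2 * k) / k * ((1 - q t ^ 2) / 2) - q' t) =
      D * Real.exp (2 * k * y t) * (ρ + 2 * θ * q t) ^ k
  tendsto_y : Tendsto y atBot atBot
  tendsto_q : Tendsto q atBot (nhds 1)

namespace CylindricalSoliton

variable {n k : ℕ} {θ ρ D : ℝ} {y q q' : ℝ → ℝ}

theorem M_nonneg (h : CylindricalSoliton n k θ ρ D y q q') : 0 ≤ ((n : ℝ) - 2 * k) / k := by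
  have : ((2 * k : ℕ) : ℝ) ≤ n := by exact_mod_cast h.hnk
  push_cast at this
  exact div_nonneg (by linarith) (by positivity)

/-- The damping inequality: wherever `|q| < 1`, the source term drives `q` down. -/
theorem deriv_le (h : CylindricalSoliton n k θ ρ D y q q') {t : ℝ} (ht : -1 < q t) :
    q' t ≤ ((n : ℝ) - 2 * k) / k / 2 - D * Real.exp (2 * k * y t) * (ρ + 2 * θ * q t) ^ k := by
  have h1 := h.lt_one t
  have ha : 0 < (1 - q t ^ 2) / 2 := by nlinarith
  have ha' : (1 - q t ^ 2) / 2 ≤ 1 / 2 := by nlinarith [sq_nonneg (q t)]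
  have hp : ((1 - q t ^ 2) / 2) ^ (k - 1) ≤ 1 := pow_le_one₀ ha.le (by linarith)
  have hp0 : 0 < ((1 - q t ^ 2) / 2) ^ (k - 1) := by positivity
  have he := h.eqn t
  have hR : 0 < D * Real.exp (2 * k * y t) * (ρ + 2 * θ * q t) ^ k := by
    have := h.pos t; have := h.hD; positivity
  rw [← he] at hR ⊢
  -- The bracket is positive, so dropping its prefactor, which is at most `1`, only enlarges the
  -- product.
  have hX := (pos_iff_pos_of_mul_pos hR).1 hp0
  have hM := mul_le_mul_of_nonneg_left ha' h.M_nonneg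
  nlinarith

theorem q_gt_of_nonpos (h : CylindricalSoliton n k θ ρ D y q q') (t : ℝ) :
    -(ρ / (2 * θ)) < q t := by
  have := h.pos t
  have hθ := h.hθ
  rw [neg_lt_iff_pos_add, ← sub_neg_eq_add, sub_pos, neg_lt_iff_pos_add]
  have : ρ / (2 * θ) + q t = (ρ + 2 * θ * q t) / (2 * θ) := by field_simp
  linarith [this ▸ div_pos (h.pos t) (by positivity : 0 < 2 * θ)]

/-- With `ε = -ρ/(2θ)`, the bound `q > ε` makes `e^{2ky}` at least a multiple of `e^{2kεt}`. This
damping forces `q - ε ≤ K e^{-εt}`, which is integrable. -/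
theorem expander_bound (h : CylindricalSoliton n k θ ρ D y q q') (hρ : ρ < 0) :
    ∃ K T, ∀ t, T ≤ t → y t ≤ -(ρ / (2 * θ)) * t + K := by
  obtain ⟨ε, hε⟩ : ∃ ε, ε = -(ρ / (2 * θ)) := ⟨_, rfl⟩
  have hθ := h.hθ
  have hD := h.hD
  have hε0 : 0 < ε := by rw [hε, ← neg_div]; apply div_pos <;> linarith
  have hq : ∀ t, ε < q t := fun t => hε ▸ h.q_gt_of_nonpos t
  have hρε : ∀ t, ρ + 2 * θ * q t = 2 * θ * (q t - ε) := fun t => by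
    rw [hε]; field_simp; ring
  have hy : ∀ t, 0 ≤ t → y 0 + ε * t ≤ y t := by
    intro t ht
    have := le_of_deriv_nonpos (f := fun t => ε * t - y t) (f' := fun t => ε * 1 - q t) (t₀ := 0)
      (fun t => ((hasDerivAt_id t).const_mul ε).sub (h.deriv_y t))
      (fun t _ => by linarith [hq t]) t ht
    simp only [mul_zero] at this
    linarith
  set M := ((n : ℝ) - 2 * k) / k / 2 with hM
  have hM0 : 0 ≤ M := by have := h.M_nonneg; rw [hM]; positivity
  set c := D * Real.exp (2 * k * y 0) * (2 * θ) ^ k with hc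
  have hc0 : 0 < c := by positivity
  have hq' : ∀ t, 0 ≤ t → q' t ≤ M - c * (Real.exp (ε * t) * (Real.exp (ε * t) * (q t - ε))) ^ k := by
    intro t ht
    refine (h.deriv_le (by linarith [hq t])).trans ?_
    rw [hρε, mul_pow (2 * θ), mul_pow (Real.exp _), mul_pow (Real.exp _), ← Real.exp_nat_mul, hM]
    have : Real.exp (2 * k * y 0) * (Real.exp (k * (ε * t)) * Real.exp (k * (ε * t)))
        ≤ Real.exp (2 * k * y t) := by
      rw [← Real.exp_add, ← Real.exp_add]
      apply Real.exp_le_exp.2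
      have := mul_le_mul_of_nonneg_left (hy t ht) (by positivity : (0:ℝ) ≤ 2 * k)
      linarith
    have h2 : 0 ≤ D * (2 * θ) ^ k * (q t - ε) ^ k := by
      have : 0 < q t - ε := by linarith [hq t]
      positivity
    have := mul_le_mul_of_nonneg_left this h2
    rw [hc]
    linarith
  -- Past `T` the damping, at least `c e^{εT} K` when `e^{εt}(q-ε) = K ≥ 1`, beats both `M` and the
  -- growth `εK` caused by the weight.
  obtain ⟨T, hT0, hT⟩ : ∃ T, 0 ≤ T ∧ ε + M < c * Real.exp (ε * T) := by
    have : Tendsto (fun T => c * Real.exp (ε * T)) atTop atTop :=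
      (Real.tendsto_exp_atTop.comp (tendsto_id.const_mul_atTop hε0)).const_mul_atTop hc0
    obtain ⟨T, h1, h2⟩ := ((eventually_ge_atTop 0).and (this.eventually_gt_atTop (ε + M))).exists
    exact ⟨T, h1, h2⟩
  set K := max 1 (Real.exp (ε * T) * (q T - ε)) with hK
  have hK1 : 1 ≤ K := le_max_left _ _
  have hexp : ∀ t, HasDerivAt (fun t => Real.exp (ε * t)) (Real.exp (ε * t) * (ε * 1)) t :=
    fun t => ((hasDerivAt_id t).const_mul ε).exp
  have hZ := le_of_deriv_neg_at_level (f := fun t => Real.exp (ε * t) * (q t - ε))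
    (t₀ := T) (K := K) (fun t => (hexp t).mul ((h.deriv_q t).sub_const ε)) (le_max_right _ _) (by
      intro t ht hKt
      have ht0 := hT0.trans ht
      have h1 := hq' t ht0
      rw [hKt] at h1
      have e1 : 1 ≤ Real.exp (ε * t) := Real.one_le_exp (by positivity)
      have e2 : Real.exp (ε * T) ≤ Real.exp (ε * t) :=
        Real.exp_le_exp.2 (mul_le_mul_of_nonneg_left ht hε0.le)
      have e3 : Real.exp (ε * t) * K ≤ (Real.exp (ε * t) * K) ^ k :=
        le_self_pow₀ (by nlinarith) (by have := h.hk; omega)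
      set E := Real.exp (ε * t)
      have h3 : q' t < -ε * K := by
        have s1 : c * (E * K) ≤ c * (E * K) ^ k := mul_le_mul_of_nonneg_left e3 hc0.le
        have s2 : c * Real.exp (ε * T) * K ≤ c * E * K := by gcongr
        have s3 : (ε + M) * K < c * Real.exp (ε * T) * K := by gcongr
        nlinarith
      have h4 : E * (ε * 1) * (q t - ε) = ε * K := by rw [← hKt]; ring
      rw [h4]
      have : E * q' t ≤ 1 * q' t := mul_le_mul_of_nonpos_right e1 (by nlinarith)
      linarith)
  -- The added exponential has derivative `-K e^{-εt}`, which absorbs the bound on `q - ε`.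
  have hfin := le_of_deriv_nonpos (f := fun t => y t - ε * t + K / ε * Real.exp (-ε * t))
    (f' := fun t => q t - ε * 1 + K / ε * (Real.exp (-ε * t) * (-ε * 1))) (t₀ := T)
    (fun t => ((h.deriv_y t).sub ((hasDerivAt_id t).const_mul ε)).add
      ((((hasDerivAt_id t).const_mul (-ε)).exp).const_mul _)) (by
      intro t ht
      have h1 := hZ t ht
      have : q t - ε ≤ K * Real.exp (-ε * t) := by
        rw [neg_mul, Real.exp_neg, ← div_eq_mul_inv, le_div_iff₀ (Real.exp_pos _)]; linarith
      have e : K / ε * (Real.exp (-ε * t) * (-ε * 1)) = - (K * Real.exp (-ε * t)) := by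
        field_simp
      rw [e]; linarith)
  refine ⟨y T - ε * T + K / ε * Real.exp (-ε * T), T, fun t ht => ?_⟩
  have h1 := hfin t ht
  have : 0 < K / ε * Real.exp (-ε * t) := by positivity
  rw [← hε]
  linarith

theorem hasDerivAt_exp_two_mul (h : CylindricalSoliton n k θ ρ D y q q') (t : ℝ) :
    HasDerivAt (fun t => Real.exp (2 * y t)) (Real.exp (2 * y t) * (2 * q t)) t :=
  ((h.deriv_y t).const_mul 2).exp

theorem steady_deriv_le (h : CylindricalSoliton n k θ 0 D y q q') (t : ℝ) :
    0 < q t ∧ q' t ≤ ((n : ℝ) - 2 * k) / k / 2 -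
      D * (2 * θ) ^ k * (Real.exp (2 * y t) * q t) ^ k := by
  have hq : 0 < q t := by simpa using h.q_gt_of_nonpos t
  refine ⟨hq, (h.deriv_le (by linarith)).trans (le_of_eq ?_)⟩
  rw [zero_add, mul_pow (2 * θ), mul_pow (Real.exp _), ← Real.exp_nat_mul]
  have : (k : ℝ) * (2 * y t) = 2 * k * y t := by ring
  rw [this]; ring

/-- The quantity `z = e^{2y} q` has derivative `e^{2y}(2q² + q')`, negative once `z` is large
because `q' ≤ M - c z^k`. Hence `z` is bounded and `e^{2y}` grows at most linearly. -/
theorem steady_bound (h : CylindricalSoliton n k θ 0 D y q q') :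
    ∃ K, ∀ t, 1 ≤ t → Real.exp (2 * y t) ≤ K * t := by
  have hθ := h.hθ
  have hD := h.hD
  set M := ((n : ℝ) - 2 * k) / k / 2 with hM
  have hM0 : 0 ≤ M := by have := h.M_nonneg; rw [hM]; positivity
  set c := D * (2 * θ) ^ k with hc
  have hc0 : 0 < c := by positivity
  -- The first entry gives `cK > 2 + M`, where `2` dominates `2q²`, and `K ≥ 1`, so that `K ≤ K^k`.
  set K := max (1 + (2 + M) / c) (Real.exp (2 * y 0) * q 0) with hK
  have hK1 : 1 + (2 + M) / c ≤ K := le_max_left _ _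
  have hK2 : 1 ≤ K := by
    have : 0 ≤ (2 + M) / c := by positivity
    linarith
  have hz := le_of_deriv_neg_at_level (f := fun t => Real.exp (2 * y t) * q t)
    (t₀ := 0) (K := K) (fun t => (h.hasDerivAt_exp_two_mul t).mul (h.deriv_q t))
    (le_max_right _ _) (by
      intro t _ hKt
      obtain ⟨h0, h1⟩ := h.steady_deriv_le t
      rw [hKt] at h1
      have h2 : K ≤ K ^ k := le_self_pow₀ hK2 (by have := h.hk; omega)
      have h3 : 2 + M < c * K := by
        have : (2 + M) / c < K := by linarith
        rw [div_lt_iff₀ hc0] at this; linarith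
      have h4 : 2 * q t * q t ≤ 2 := by nlinarith [h.lt_one t]
      have h5 : 2 * q t * q t + q' t < 0 := by nlinarith
      have := mul_neg_of_pos_of_neg (Real.exp_pos (2 * y t)) h5
      linarith)
  have hfin := le_of_deriv_nonpos (f := fun t => Real.exp (2 * y t) - 2 * K * t)
    (f' := fun t => Real.exp (2 * y t) * (2 * q t) - 2 * K * 1) (t₀ := 0)
    (fun t => (h.hasDerivAt_exp_two_mul t).sub ((hasDerivAt_id t).const_mul _))
    (fun t ht => by have := hz t ht; linarith)
  refine ⟨Real.exp (2 * y 0) + 2 * K, fun t ht => ?_⟩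
  have h1 := hfin t (by linarith)
  simp only [mul_zero, sub_zero] at h1
  have := mul_le_mul_of_nonneg_left ht (Real.exp_pos (2 * y 0)).le
  linarith

/-- Here `M = 0`, so `c z^k ≤ -q'` with `z = e^{2y} q`, and `0 < q < 1` bounds the integral of
`z^k`. Young's inequality, a substitute for Hölder, then controls the integral of `z`. -/
theorem steady_bound_of_eq (h : CylindricalSoliton n k θ 0 D y q q') (hn : n = 2 * k) :
    ∃ K, ∀ t, 1 ≤ t → Real.exp (2 * y t) ≤ K * t ^ (1 - 1 / (k : ℝ)) := by
  have hθ := h.hθ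
  have hD := h.hD
  have hk := h.hk
  have hk0 : (0 : ℝ) < k := by exact_mod_cast hk
  have hM : ((n : ℝ) - 2 * k) / k / 2 = 0 := by rw [hn]; push_cast; simp
  set c := D * (2 * θ) ^ k with hc
  have hc0 : 0 < c := by positivity
  -- Either `z ≤ 1/s`, or `sz ≥ 1` and `z ≤ (sz)^(k-1) z`.
  have young : ∀ s z : ℝ, 0 < s → 0 < z → z ≤ s ^ (k - 1) * z ^ k + 1 / s := by
    intro s z hs hz
    rcases le_total z (1 / s) with h1 | h1
    · have : 0 < s ^ (k - 1) * z ^ k := by positivity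
      linarith
    · have h2 : 1 ≤ s * z := by rw [div_le_iff₀ hs] at h1; linarith
      have h3 : s ^ (k - 1) * z ^ k = (s * z) ^ (k - 1) * z := by
        obtain ⟨j, rfl⟩ : ∃ j, k = j + 1 := ⟨k - 1, by omega⟩
        simp only [Nat.add_sub_cancel]; rw [mul_pow, pow_succ]; ring
      have h4 : 1 ≤ (s * z) ^ (k - 1) := one_le_pow₀ h2
      have h5 : 0 < 1 / s := by positivity
      rw [h3]; nlinarith
  have key : ∀ s T : ℝ, 0 < s → 0 ≤ T →
      Real.exp (2 * y T) ≤ Real.exp (2 * y 0) + 2 / c * s ^ (k - 1) + 2 * T / s := by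
    intro s T hs hT
    have hfin := le_of_deriv_nonpos
      (f := fun t => Real.exp (2 * y t) + 2 / c * s ^ (k - 1) * q t - 2 / s * t)
      (f' := fun t => Real.exp (2 * y t) * (2 * q t) + 2 / c * s ^ (k - 1) * q' t - 2 / s * 1)
      (t₀ := 0)
      (fun t => ((h.hasDerivAt_exp_two_mul t).add ((h.deriv_q t).const_mul _)).sub
        ((hasDerivAt_id t).const_mul _)) (by
        intro t _
        obtain ⟨h0, h1⟩ := h.steady_deriv_le t
        rw [hM, zero_sub] at h1
        have h2 := young s _ hs (mul_pos (Real.exp_pos (2 * y t)) h0)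
        have h3 := mul_le_mul_of_nonneg_left h1 (by positivity : 0 ≤ 2 / c * s ^ (k - 1))
        have h4 : 2 / c * s ^ (k - 1) * -(c * (Real.exp (2 * y t) * q t) ^ k) =
          -(2 * (s ^ (k - 1) * (Real.exp (2 * y t) * q t) ^ k)) := by field_simp
        have h5 : 2 / s = 2 * (1 / s) := by ring
        rw [← hc, h4] at h3
        rw [h5]; linarith) T hT
    simp only [mul_zero, sub_zero] at hfin
    have hqT := (h.steady_deriv_le T).1
    have hq0 := h.lt_one 0
    have h6 : 0 ≤ 2 / c * s ^ (k - 1) := by positivity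
    have h7 := mul_nonneg h6 hqT.le
    have h8 := mul_le_mul_of_nonneg_left hq0.le h6
    have h9 : 2 * T / s = 2 / s * T := by ring
    rw [h9]; linarith
  refine ⟨Real.exp (2 * y 0) + 2 / c + 2, fun t ht => ?_⟩
  have ht0 : 0 < t := by linarith
  -- The choice `s = t^(1/k)` balances `s^(k-1)` against `t/s`; both equal `t^(1-1/k)`.
  have h1 := key (t ^ (1 / (k : ℝ))) t (by positivity) ht0.le
  have e1 : (t ^ (1 / (k : ℝ))) ^ (k - 1) = t ^ (1 - 1 / (k : ℝ)) := by
    rw [← Real.rpow_natCast, ← Real.rpow_mul ht0.le]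
    congr 1
    rw [Nat.cast_sub hk]; field_simp; simp
  have e2 : 2 * t / t ^ (1 / (k : ℝ)) = 2 * t ^ (1 - 1 / (k : ℝ)) := by
    rw [Real.rpow_sub ht0, Real.rpow_one]; ring
  have e3 : 1 ≤ t ^ (1 - 1 / (k : ℝ)) := by
    apply Real.one_le_rpow ht
    rw [sub_nonneg, div_le_one hk0]; exact_mod_cast hk
  rw [e1, e2] at h1
  have := mul_le_mul_of_nonneg_left e3 (Real.exp_pos (2 * y 0)).le
  linarith

end CylindricalSoliton
end KYamabe

/-! ### Shrinkers: the Pohozaev energy -/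

namespace KYamabe
namespace CylindricalSoliton

variable {n k : ℕ} {θ ρ D : ℝ} {y q q' : ℝ → ℝ}

/-- The Pohozaev energy, conserved for `θ = 0` and nondecreasing along shrinking solitons. -/
noncomputable def energy (n k : ℕ) (ρ D : ℝ) (y q : ℝ → ℝ) (t : ℝ) : ℝ :=
  Real.exp (((n : ℝ) - 2 * k) * y t) * (1 - q t ^ 2) ^ k -
    k * 2 ^ k * D * ρ ^ k / n * Real.exp (n * y t)

/-- Multiplying the ODE by `k 2^k q e^{(n-2k)y}` turns its left side into the derivative of the
first term of the energy. The second term removes the part of the source that survives at `θ = 0`.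
-/
theorem hasDerivAt_energy (h : CylindricalSoliton n k θ ρ D y q q') (t : ℝ) :
    HasDerivAt (energy n k ρ D y q)
      (k * 2 ^ k * D * Real.exp (n * y t) * (q t * ((ρ + 2 * θ * q t) ^ k - ρ ^ k))) t := by
  have hn0 : (n : ℝ) ≠ 0 := by
    have := h.hk; have := h.hnk
    exact_mod_cast (by omega : n ≠ 0)
  have hk0 : (k : ℝ) ≠ 0 := by have := h.hk; exact_mod_cast (by omega : k ≠ 0)
  have h1 := ((((h.deriv_y t).const_mul ((n : ℝ) - 2 * k)).exp).mul
    ((((h.deriv_q t).pow 2).const_sub 1).pow k)).sub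
    ((((h.deriv_y t).const_mul (n : ℝ)).exp).const_mul (k * 2 ^ k * D * ρ ^ k / n))
  refine h1.congr_deriv ?_
  simp only [Pi.pow_apply]
  have he := h.eqn t
  obtain ⟨j, hj⟩ : ∃ j, k = j + 1 := ⟨k - 1, by have := h.hk; omega⟩
  have e1 : Real.exp (n * y t) = Real.exp (((n : ℝ) - 2 * k) * y t) * Real.exp (2 * k * y t) := by
    rw [← Real.exp_add]; congr 1; ring
  have e2 : k * 2 ^ k * D * Real.exp (n * y t) * (q t * ((ρ + 2 * θ * q t) ^ k - ρ ^ k)) =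
      k * 2 ^ k * q t * Real.exp (((n : ℝ) - 2 * k) * y t) *
        (D * Real.exp (2 * k * y t) * (ρ + 2 * θ * q t) ^ k)
      - k * 2 ^ k * D * ρ ^ k * Real.exp (n * y t) * q t := by rw [e1]; ring
  have e3 : (1 - q t ^ 2) = 2 * ((1 - q t ^ 2) / 2) := by ring
  rw [e2, ← he, e3]
  set a := (1 - q t ^ 2) / 2
  have e4 : k - 1 = j := by omega
  rw [e4, mul_pow, mul_pow]
  have e5 : a ^ k = a ^ j * a := by rw [hj, pow_succ]
  have e6 : (2 : ℝ) ^ k = 2 ^ j * 2 := by rw [hj, pow_succ]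
  rw [e5, e6]
  field_simp
  ring

/-- Since `θ > 0`, the factors `q` and `(ρ+2θq)^k - ρ^k` have the same sign. -/
theorem energy_deriv_nonneg (h : CylindricalSoliton n k θ ρ D y q q') (hρ : 0 < ρ) (t : ℝ) :
    0 ≤ k * 2 ^ k * D * Real.exp (n * y t) * (q t * ((ρ + 2 * θ * q t) ^ k - ρ ^ k)) := by
  have hD := h.hD
  have hθ := h.hθ
  apply mul_nonneg (by positivity)
  rcases le_total 0 (q t) with h0 | h0
  · refine mul_nonneg h0 (sub_nonneg.2 (pow_le_pow_left₀ hρ.le ?_ k))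
    nlinarith
  · refine mul_nonneg_of_nonpos_of_nonpos h0 (sub_nonpos.2 (pow_le_pow_left₀ (h.pos t).le ?_ k))
    nlinarith

theorem energy_deriv_pos (h : CylindricalSoliton n k θ ρ D y q q') (hρ : 0 < ρ) {t : ℝ}
    (h0 : 0 < q t) :
    0 < k * 2 ^ k * D * Real.exp (n * y t) * (q t * ((ρ + 2 * θ * q t) ^ k - ρ ^ k)) := by
  have hD := h.hD
  have hθ := h.hθ
  have hk := h.hk
  apply mul_pos (by positivity)
  refine mul_pos h0 (sub_pos.2 (pow_lt_pow_left₀ ?_ hρ.le (by omega)))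
  nlinarith [mul_pos hθ h0]

theorem energy_monotone (h : CylindricalSoliton n k θ ρ D y q q') (hρ : 0 < ρ) :
    Monotone (energy n k ρ D y q) :=
  monotone_of_hasDerivAt_nonneg h.hasDerivAt_energy (h.energy_deriv_nonneg hρ)

/-- In the first term the decay comes from `1 - q² → 0`, the exponential being merely bounded when
`n = 2k`. -/
theorem energy_tendsto (h : CylindricalSoliton n k θ ρ D y q q') :
    Tendsto (energy n k ρ D y q) atBot (nhds 0) := by
  have hk := h.hk
  have hnk := h.hnk
  have hn : (0 : ℝ) < n := by exact_mod_cast (by omega : 0 < n)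
  have hnk' : (0 : ℝ) ≤ (n : ℝ) - 2 * k := by
    have : ((2 * k : ℕ) : ℝ) ≤ n := by exact_mod_cast hnk
    push_cast at this; linarith
  have h2 : Tendsto (fun t => Real.exp (n * y t)) atBot (nhds 0) :=
    Real.tendsto_exp_atBot.comp (h.tendsto_y.const_mul_atBot hn)
  have h3 : Tendsto (fun t => (1 - q t ^ 2) ^ k) atBot (nhds 0) := by
    have := ((h.tendsto_q.pow 2).const_sub 1).pow k
    simpa [zero_pow (by omega : k ≠ 0)] using this
  have h4 : Tendsto (fun t => Real.exp (((n : ℝ) - 2 * k) * y t) * (1 - q t ^ 2) ^ k) atBot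
      (nhds 0) := by
    refine h3.zero_mul_isBoundedUnder_le ?_ |>.congr (fun t => mul_comm _ _)
    refine ⟨1, ?_⟩
    rw [eventually_map]
    filter_upwards [h.tendsto_y.eventually_le_atBot 0] with t ht
    simp only [Function.comp, Real.norm_eq_abs, Real.abs_exp]
    exact Real.exp_le_one_iff.2 (mul_nonpos_of_nonneg_of_nonpos hnk' ht)
  have h5 := h4.sub (h2.const_mul (k * 2 ^ k * D * ρ ^ k / n))
  rw [mul_zero, sub_zero] at h5
  exact h5

/-- A zero of the energy would make it vanish on a whole left half-line, but near `-∞` one has `q >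
0` and the energy strictly increases. -/
theorem energy_pos (h : CylindricalSoliton n k θ ρ D y q q') (hρ : 0 < ρ) (t : ℝ) :
    0 < energy n k ρ D y q t := by
  have hm := h.energy_monotone hρ
  have h0 : ∀ t, 0 ≤ energy n k ρ D y q t := fun t =>
    le_of_tendsto h.energy_tendsto ((eventually_le_atBot t).mono fun s hs => hm hs)
  refine lt_of_le_of_ne (h0 t) fun heq => ?_
  obtain ⟨s, hs, hqs⟩ := ((eventually_lt_atBot t).and
    (h.tendsto_q.eventually (lt_mem_nhds (zero_lt_one' ℝ)))).exists
  have hz : energy n k ρ D y q =ᶠ[nhds s] fun _ => 0 := by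
    filter_upwards [gt_mem_nhds hs] with r hr
    exact le_antisymm (heq ▸ hm hr.le) (h0 r)
  have := (h.hasDerivAt_energy s).unique ((hasDerivAt_const s (0 : ℝ)).congr_of_eventuallyEq hz)
  exact (h.energy_deriv_pos hρ hqs).ne' this

theorem energy_le (h : CylindricalSoliton n k θ ρ D y q q') (hρ : 0 < ρ) (t : ℝ) :
    energy n k ρ D y q t ≤ Real.exp (((n : ℝ) - 2 * k) * y t) * (1 - q t ^ 2) ^ k := by
  have := h.hD
  have : 0 ≤ k * 2 ^ k * D * ρ ^ k / n * Real.exp (n * y t) := by positivity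
  rw [energy]; linarith

/-- Going from near `1` to `-1` or below, `q` would take the value `-1`, where the energy is at most
`0`. -/
theorem neg_one_lt (h : CylindricalSoliton n k θ ρ D y q q') (hρ : 0 < ρ) (t : ℝ) :
    -1 < q t := by
  by_contra hcon
  push Not at hcon
  obtain ⟨s, hs, hqs⟩ := ((eventually_lt_atBot t).and
    (h.tendsto_q.eventually (lt_mem_nhds (zero_lt_one' ℝ)))).exists
  have hc : ContinuousOn q (Set.Icc s t) := fun x _ =>
    (h.deriv_q x).continuousAt.continuousWithinAt
  obtain ⟨r, _, hr⟩ := intermediate_value_Icc' hs.le hc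
    (show (-1 : ℝ) ∈ Set.Icc (q t) (q s) from ⟨hcon, by linarith⟩)
  have h1 := h.energy_pos hρ r
  have h2 := h.energy_le hρ r
  rw [hr] at h2
  have hk := h.hk
  norm_num [zero_pow (by omega : k ≠ 0)] at h2
  linarith

/-- Monotonicity gives `energy(0) ≤ e^{(n-2k)y}`, a lower bound for `y`; positivity gives `c e^{ny}
≤ e^{(n-2k)y}`, an upper bound. No comparison of `ρ` with `2θ` enters. -/
theorem shrinker_bound (h : CylindricalSoliton n k θ ρ D y q q') (hρ : 0 < ρ) (hn : 2 * k < n) :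
    ∃ K, ∀ t, 0 ≤ t → |y t| ≤ K := by
  have hk := h.hk
  have hD := h.hD
  have hk0 : (0 : ℝ) < k := by exact_mod_cast hk
  have hn0 : (0 : ℝ) < n := by exact_mod_cast (by omega : 0 < n)
  have hnk' : (0 : ℝ) < (n : ℝ) - 2 * k := by
    have : ((2 * k : ℕ) : ℝ) < n := by exact_mod_cast hn
    push_cast at this; linarith
  have hc0 : 0 < k * 2 ^ k * D * ρ ^ k / n := by positivity
  set c := k * 2 ^ k * D * ρ ^ k / n with hc
  have hE0 := h.energy_pos hρ 0
  refine ⟨|Real.log (energy n k ρ D y q 0) / (n - 2 * k)| + |-Real.log c / (2 * k)|, fun t ht => ?_⟩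
  have hE := h.energy_monotone hρ ht
  have h1 := h.lt_one t
  have h2 := h.neg_one_lt hρ t
  have hp : (1 - q t ^ 2) ^ k ≤ 1 := pow_le_one₀ (by nlinarith) (by nlinarith [sq_nonneg (q t)])
  have hle : Real.exp (((n : ℝ) - 2 * k) * y t) * (1 - q t ^ 2) ^ k ≤
      Real.exp (((n : ℝ) - 2 * k) * y t) := mul_le_of_le_one_right (Real.exp_pos _).le hp
  have hlo : Real.log (energy n k ρ D y q 0) / (n - 2 * k) ≤ y t := by
    rw [div_le_iff₀ hnk', mul_comm, Real.log_le_iff_le_exp hE0]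
    exact hE.trans ((h.energy_le hρ t).trans hle)
  have hhi : y t ≤ -Real.log c / (2 * k) := by
    have h3 : c * Real.exp (n * y t) ≤ Real.exp (((n : ℝ) - 2 * k) * y t) := by
      have := h.energy_pos hρ t
      rw [energy, ← hc] at this
      linarith
    have e1 : Real.exp (n * y t) = Real.exp (((n : ℝ) - 2 * k) * y t) * Real.exp (2 * k * y t) := by
      rw [← Real.exp_add]; congr 1; ring
    have h4 : Real.log c + 2 * k * y t ≤ 0 := by
      rw [← Real.exp_le_one_iff, Real.exp_add, Real.exp_log hc0]
      rw [e1] at h3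
      have := Real.exp_pos (((n : ℝ) - 2 * k) * y t)
      by_contra hcon
      push Not at hcon
      nlinarith
    rw [le_div_iff₀ (by positivity)]; linarith
  rw [abs_le]
  constructor
  · linarith [neg_abs_le (Real.log (energy n k ρ D y q 0) / (n - 2 * k)),
      abs_nonneg (-Real.log c / (2 * k))]
  · linarith [le_abs_self (-Real.log c / (2 * k)),
      abs_nonneg (Real.log (energy n k ρ D y q 0) / (n - 2 * k))]

/-- In the critical dimension `n = 2k` the profile `q` decreases, and the energy keeps `|q|` away
from `1`. -/
theorem critical_deriv_bounds (h : CylindricalSoliton n k θ ρ D y q q') (hρ : 0 < ρ)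
    (hn : n = 2 * k) :
    (∀ t, q' t ≤ -(D * Real.exp (2 * k * y t) * (ρ + 2 * θ * q t) ^ k)) ∧
    ∃ B, 0 < B ∧ ∀ t, 0 ≤ t → -q' t ≤ B * Real.exp (2 * k * y t) := by
  have hM : ((n : ℝ) - 2 * k) / k = 0 := by rw [hn]; push_cast; simp
  have hM' : (n : ℝ) - 2 * k = 0 := by rw [hn]; push_cast; simp
  have hk := h.hk
  have hθ := h.hθ
  have hD := h.hD
  constructor
  · intro t
    have := h.deriv_le (h.neg_one_lt hρ t)
    rw [hM] at this
    linarith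
  · have hE0 := h.energy_pos hρ 0
    set e := energy n k ρ D y q 0
    refine ⟨2 ^ (k - 1) / e * (D * (ρ + 2 * θ) ^ k), by positivity, fun t ht => ?_⟩
    have hE := (h.energy_monotone hρ ht).trans (h.energy_le hρ t)
    -- With `n = 2k` the exponential weight is `1`, so the energy at `0` bounds `(1-q²)^k` below and
    -- the degenerate factor of `q'` can be divided out.
    rw [hM', zero_mul, Real.exp_zero, one_mul] at hE
    have h1 := h.lt_one t
    have h2 := h.neg_one_lt hρ t
    have he := h.eqn t
    have hR : (ρ + 2 * θ * q t) ^ k ≤ (ρ + 2 * θ) ^ k :=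
      pow_le_pow_left₀ (h.pos t).le (by nlinarith) k
    have ha : (1 - q t ^ 2) ^ k ≤ (1 - q t ^ 2) ^ (k - 1) :=
      pow_le_pow_of_le_one (by nlinarith) (by nlinarith [sq_nonneg (q t)]) (by omega)
    have hE' : e ≤ (1 - q t ^ 2) ^ (k - 1) := hE.trans ha
    rw [hM, zero_mul, zero_sub, div_pow, div_mul_eq_mul_div, div_eq_iff (by positivity)] at he
    have hq' : 0 ≤ -q' t := by
      by_contra hcon
      push Not at hcon
      have hl := mul_neg_of_pos_of_neg (hE0.trans_le hE') hcon
      have := pow_pos (h.pos t) k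
      have : 0 < D * Real.exp (2 * k * y t) * (ρ + 2 * θ * q t) ^ k * 2 ^ (k - 1) := by positivity
      linarith
    have h3 := mul_le_mul_of_nonneg_right hE' hq'
    have h4 : D * Real.exp (2 * k * y t) * (ρ + 2 * θ * q t) ^ k * 2 ^ (k - 1) ≤
        D * Real.exp (2 * k * y t) * (ρ + 2 * θ) ^ k * 2 ^ (k - 1) := by gcongr
    have h5 : 2 ^ (k - 1) / e * (D * (ρ + 2 * θ) ^ k) * Real.exp (2 * k * y t) =
        (D * Real.exp (2 * k * y t) * (ρ + 2 * θ) ^ k * 2 ^ (k - 1)) / e := by ring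
    rw [h5, le_div_iff₀ hE0]
    linarith

/-- The function `-q` increases to a limit `d`. Once `d > 0`, `e^{2ky}` decays exponentially, hence
so does `q'`, and `q + d` is integrable. -/
theorem critical_shrinker_bound (h : CylindricalSoliton n k θ ρ D y q q') (hρ : 0 < ρ)
    (hn : n = 2 * k) :
    ∃ d, 0 < d ∧ d ≤ min (ρ / (2 * θ)) 1 ∧ ∃ K T, ∀ t, T ≤ t → |y t + d * t| ≤ K := by
  obtain ⟨hq', B, hB, hqB⟩ := h.critical_deriv_bounds hρ hn
  have hθ := h.hθ
  have hD := h.hD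
  have hk0 : (0 : ℝ) < k := by have := h.hk; exact_mod_cast this
  have hlow : ∀ t, 0 < D * Real.exp (2 * k * y t) * (ρ + 2 * θ * q t) ^ k := fun t => by
    have := h.pos t; positivity
  have hbd : ∀ t, -q t ≤ min (ρ / (2 * θ)) 1 := fun t =>
    le_min (by linarith [h.q_gt_of_nonpos t]) (by linarith [h.neg_one_lt hρ t])
  have hmono : Monotone fun t => -q t :=
    monotone_of_hasDerivAt_nonneg (fun t => (h.deriv_q t).neg)
      (fun t => by simp only [Pi.zero_apply]; linarith [hq' t, hlow t])
  have hbdd : BddAbove (Set.range fun t => -q t) := ⟨_, by rintro _ ⟨t, rfl⟩; exact hbd t⟩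
  obtain ⟨d, hd⟩ : ∃ d, d = ⨆ t, -q t := ⟨_, rfl⟩
  have htend : Tendsto (fun t => -q t) atTop (nhds d) := hd ▸ tendsto_atTop_ciSup hmono hbdd
  have hqd : ∀ t, -q t ≤ d := fun t => hd ▸ le_ciSup hbdd t
  have hd0 : 0 < d := by
    -- Otherwise `q ≥ 0` throughout, `y` never falls below `y 0` for `t ≥ 0`, and `q' ≤ -c` makes
    -- `q` negative by time `1/c`.
    by_contra hcon
    push Not at hcon
    have hq0 : ∀ t, 0 ≤ q t := fun t => by linarith [hqd t]
    have hy0 : ∀ t, 0 ≤ t → y 0 ≤ y t := fun t ht => by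
      have := le_of_deriv_nonpos (fun t => (h.deriv_y t).neg) (t₀ := 0)
        (fun t _ => by linarith [hq0 t]) t ht
      simp only [Pi.neg_apply] at this
      linarith
    set c := D * Real.exp (2 * k * y 0) * ρ ^ k with hc
    have hc0 : 0 < c := by positivity
    have := le_of_deriv_nonpos (f := fun t => q t + c * t) (f' := fun t => q' t + c * 1) (t₀ := 0)
      (fun t => (h.deriv_q t).add ((hasDerivAt_id t).const_mul c)) (fun t ht => by
        have h1 := hq' t
        have h2 : Real.exp (2 * k * y 0) ≤ Real.exp (2 * k * y t) :=
          Real.exp_le_exp.2 (mul_le_mul_of_nonneg_left (hy0 t ht) (by positivity))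
        have h3 : ρ ^ k ≤ (ρ + 2 * θ * q t) ^ k :=
          pow_le_pow_left₀ hρ.le (by nlinarith [hq0 t]) k
        have h4 : c ≤ D * Real.exp (2 * k * y t) * (ρ + 2 * θ * q t) ^ k := by
          rw [hc]; gcongr
        linarith) (1 / c) (by positivity)
    simp only [mul_zero, add_zero] at this
    rw [mul_one_div_cancel hc0.ne'] at this
    linarith [hq0 (1 / c), h.lt_one 0]
  refine ⟨d, hd0, hd ▸ ciSup_le hbd, ?_⟩
  -- The crude rate `d/2` for `y` suffices: it gives `e^{2ky}` the decay `e^{-bt}` with `b = kd`.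
  obtain ⟨T, hT0, hT⟩ : ∃ T, 0 ≤ T ∧ ∀ t, T ≤ t → d / 2 ≤ -q t := by
    obtain ⟨T, h1, h2⟩ := ((eventually_ge_atTop 0).and
      (htend.eventually (lt_mem_nhds (half_lt_self hd0)))).exists
    exact ⟨T, h1, fun t ht => h2.le.trans (hmono ht)⟩
  have hy : ∀ t, T ≤ t → y t ≤ y T + d / 2 * T - d / 2 * t := fun t ht => by
    have := le_of_deriv_nonpos (f := fun t => y t + d / 2 * t) (f' := fun t => q t + d / 2 * 1)
      (fun t => (h.deriv_y t).add ((hasDerivAt_id t).const_mul _))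
      (fun t ht => by linarith [hT t ht]) t ht
    linarith
  set A := B * Real.exp (2 * k * (y T + d / 2 * T)) with hA
  have hA0 : 0 < A := by positivity
  set b := k * d with hb
  have hb0 : 0 < b := by positivity
  have hexp : ∀ (c t : ℝ), HasDerivAt (fun t => c * Real.exp (-b * t))
      (c * (Real.exp (-b * t) * (-b * 1))) t :=
    fun c t => (((hasDerivAt_id t).const_mul (-b)).exp).const_mul c
  have hqexp : ∀ t, T ≤ t → -q' t ≤ A * Real.exp (-b * t) := fun t ht => by
    refine (hqB t (hT0.trans ht)).trans ?_
    rw [hA, mul_assoc B, ← Real.exp_add]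
    refine mul_le_mul_of_nonneg_left (Real.exp_le_exp.2 ?_) hB.le
    have := mul_le_mul_of_nonneg_left (hy t ht) (by positivity : (0 : ℝ) ≤ 2 * k)
    rw [hb]; linarith
  have hrate : ∀ t, T ≤ t → d ≤ -q t + A / b * Real.exp (-b * t) := fun t ht => by
    refine le_of_tendsto htend ((eventually_ge_atTop t).mono fun s hs => ?_)
    have := le_of_deriv_nonpos (f := fun t => -q t + A / b * Real.exp (-b * t))
      (fun t => (h.deriv_q t).neg.add (hexp (A / b) t)) (t₀ := t) (fun r hr => by
        have := hqexp r (ht.trans hr)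
        have e : A / b * (Real.exp (-b * r) * (-b * 1)) = -(A * Real.exp (-b * r)) := by
          field_simp
        rw [e]; linarith) s hs
    have h2 : 0 < A / b * Real.exp (-b * s) := by positivity
    linarith
  have hup : ∀ t, T ≤ t → y t + d * t ≤ y T + d * T + A / b / b * Real.exp (-b * T) :=
    fun t ht => by
    have := le_of_deriv_nonpos (f := fun t => y t + d * t + A / b / b * Real.exp (-b * t))
      (fun t => ((h.deriv_y t).add ((hasDerivAt_id t).const_mul d)).add (hexp (A / b / b) t))
      (t₀ := T) (fun t ht => by
        have := hrate t ht
        have e : A / b / b * (Real.exp (-b * t) * (-b * 1)) = -(A / b * Real.exp (-b * t)) := by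
          field_simp
        rw [e]; linarith) t ht
    have h2 : 0 < A / b / b * Real.exp (-b * t) := by positivity
    linarith
  -- Since `-q ≤ d`, the function `y + dt` is nondecreasing.
  have hdown : ∀ t, T ≤ t → y T + d * T ≤ y t + d * t := fun t ht => by
    have := le_of_deriv_nonpos (f := fun t => -(y t + d * t))
      (fun t => ((h.deriv_y t).add ((hasDerivAt_id t).const_mul d)).neg) (t₀ := T)
      (fun t _ => by linarith [hqd t]) t ht
    linarith
  have hc : 0 < A / b / b * Real.exp (-b * T) := by positivity
  refine ⟨|y T + d * T| + A / b / b * Real.exp (-b * T), T, fun t ht => abs_le.2 ⟨?_, ?_⟩⟩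
  · linarith [hdown t ht, neg_abs_le (y T + d * T)]
  · linarith [hup t ht, le_abs_self (y T + d * T)]

end CylindricalSoliton
end KYamabe

/-! ### Curvature of conformally flat metrics -/

namespace KYamabe

section PartialDeriv

variable {n : ℕ} {f g : EuclideanSpace ℝ (Fin n) → ℝ} {x : EuclideanSpace ℝ (Fin n)}

theorem contDiff_partialDeriv (hf : ContDiff ℝ ∞ f) (i : Fin n) :
    ContDiff ℝ ∞ (partialDeriv i f) :=
  (hf.fderiv_right (m := ∞) (by simp)).clm_apply contDiff_const

theorem partialDeriv_eq {f' : EuclideanSpace ℝ (Fin n) →L[ℝ] ℝ} (h : HasFDerivAt f f' x)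
    (i : Fin n) : partialDeriv i f x = f' (EuclideanSpace.single i 1) := by
  rw [partialDeriv, h.fderiv]

theorem partialDeriv_comp {φ : ℝ → ℝ} {φ' : ℝ} (hφ : HasDerivAt φ φ' (f x))
    (hf : DifferentiableAt ℝ f x) (i : Fin n) :
    partialDeriv i (fun y => φ (f y)) x = φ' * partialDeriv i f x := by
  exact partialDeriv_eq (hφ.comp_hasFDerivAt x hf.hasFDerivAt) i

theorem partialDeriv_mul_const (hf : DifferentiableAt ℝ f x) (c : ℝ) (i : Fin n) :
    partialDeriv i (fun y => f y * c) x = partialDeriv i f x * c := by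
  exact (partialDeriv_comp ((hasDerivAt_id (f x)).mul_const c) hf i).trans (by ring)

theorem partialDeriv_mul (hf : DifferentiableAt ℝ f x) (hg : DifferentiableAt ℝ g x) (i : Fin n) :
    partialDeriv i (fun y => f y * g y) x =
      f x * partialDeriv i g x + g x * partialDeriv i f x := by
  exact partialDeriv_eq (hf.hasFDerivAt.mul hg.hasFDerivAt) i

theorem partialDeriv_add (hf : DifferentiableAt ℝ f x) (hg : DifferentiableAt ℝ g x) (i : Fin n) :
    partialDeriv i (fun y => f y + g y) x = partialDeriv i f x + partialDeriv i g x := by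
  exact partialDeriv_eq (hf.hasFDerivAt.add hg.hasFDerivAt) i

theorem partialDeriv_sub (hf : DifferentiableAt ℝ f x) (hg : DifferentiableAt ℝ g x) (i : Fin n) :
    partialDeriv i (fun y => f y - g y) x = partialDeriv i f x - partialDeriv i g x := by
  exact partialDeriv_eq (hf.hasFDerivAt.sub hg.hasFDerivAt) i

theorem partialDeriv_comm (hf : ContDiff ℝ ∞ f) (i j : Fin n) (x : EuclideanSpace ℝ (Fin n)) :
    partialDeriv i (partialDeriv j f) x = partialDeriv j (partialDeriv i f) x := by
  have h2 : ∀ a b : Fin n, partialDeriv a (partialDeriv b f) x =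
      fderiv ℝ (fderiv ℝ f) x (EuclideanSpace.single a 1) (EuclideanSpace.single b 1) := by
    intro a b
    have hd : DifferentiableAt ℝ (fderiv ℝ f) x :=
      ((hf.fderiv_right (m := ∞) (by simp)).differentiable (by simp)).differentiableAt
    refine (partialDeriv_eq (hd.hasFDerivAt.clm_apply (hasFDerivAt_const _ x)) a).trans ?_
    simp
  rw [h2, h2]
  exact ((contDiff_infty.1 hf 2).contDiffAt.isSymmSndFDerivAt (by simp)) _ _

end PartialDeriv

/-- The Kronecker symbol. -/
def kronecker {n : ℕ} (i j : Fin n) : ℝ := if i = j then 1 else 0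

theorem kronecker_self {n : ℕ} (i : Fin n) : kronecker i i = 1 := if_pos rfl

theorem kronecker_comm {n : ℕ} (i j : Fin n) : kronecker i j = kronecker j i := by
  simp only [kronecker, eq_comm]

theorem sum_mul_kronecker {n : ℕ} (f : Fin n → ℝ) (i : Fin n) :
    ∑ l, f l * kronecker l i = f i := by
  simp [kronecker]

theorem one_apply_eq_kronecker {n : ℕ} (i j : Fin n) :
    (1 : Matrix (Fin n) (Fin n) ℝ) i j = kronecker i j :=
  Matrix.one_apply

section Conformal

variable {n : ℕ} {ψ : EuclideanSpace ℝ (Fin n) → ℝ}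

/-- The conformally flat metric `e^{2ψ} |dx|²`. -/
noncomputable def expMetric (ψ : EuclideanSpace ℝ (Fin n) → ℝ)
    (x : EuclideanSpace ℝ (Fin n)) : Matrix (Fin n) (Fin n) ℝ :=
  Real.exp (2 * ψ x) • (1 : Matrix (Fin n) (Fin n) ℝ)

/-- The squared Euclidean length of the gradient. -/
noncomputable def gradSq (ψ : EuclideanSpace ℝ (Fin n) → ℝ) (x : EuclideanSpace ℝ (Fin n)) : ℝ :=
  ∑ l, partialDeriv l ψ x ^ 2

/-- The Schouten tensor of `e^{2ψ} |dx|²`. -/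
noncomputable def expSchouten (ψ : EuclideanSpace ℝ (Fin n) → ℝ)
    (x : EuclideanSpace ℝ (Fin n)) : Matrix (Fin n) (Fin n) ℝ :=
  Matrix.of fun i j => -partialDeriv i (partialDeriv j ψ) x
    + partialDeriv i ψ x * partialDeriv j ψ x - gradSq ψ x / 2 * kronecker i j

theorem expMetric_inv (x : EuclideanSpace ℝ (Fin n)) :
    (expMetric ψ x)⁻¹ = Real.exp (-(2 * ψ x)) • (1 : Matrix (Fin n) (Fin n) ℝ) := by
  apply Matrix.inv_eq_right_inv
  rw [expMetric, Matrix.smul_mul, Matrix.one_mul, smul_smul, ← Real.exp_add]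
  simp

theorem christoffel_expMetric (hψ : ContDiff ℝ ∞ ψ) (a i j : Fin n) :
    christoffel (expMetric ψ) a i j = fun x => partialDeriv i ψ x * kronecker a j
      + partialDeriv j ψ x * kronecker a i
      - partialDeriv a ψ x * kronecker i j := by
  funext x
  have hd : DifferentiableAt ℝ ψ x := (hψ.differentiable (by simp)).differentiableAt
  have hp : ∀ b c d : Fin n, partialDeriv b (fun y => expMetric ψ y c d) x =
      2 * Real.exp (2 * ψ x) * partialDeriv b ψ x * kronecker c d := by
    intro b c d
    have h1 : HasDerivAt (fun s => Real.exp (2 * s) * kronecker c d)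
        (Real.exp (2 * ψ x) * (2 * 1) * kronecker c d) (ψ x) :=
      (((hasDerivAt_id (ψ x)).const_mul 2).exp).mul_const _
    have := partialDeriv_comp h1 hd b
    simp only [expMetric, Matrix.smul_apply, one_apply_eq_kronecker, smul_eq_mul]
    rw [this]; ring
  simp only [christoffel, hp, expMetric_inv, Matrix.smul_apply, one_apply_eq_kronecker, smul_eq_mul]
  have he : Real.exp (-(2 * ψ x)) * Real.exp (2 * ψ x) = 1 := by rw [← Real.exp_add]; simp
  rw [Finset.sum_eq_single a (fun l _ hl => by rw [kronecker, if_neg (Ne.symm hl)]; ring) (by simp)]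
  rw [kronecker_self, kronecker_comm j a, kronecker_comm i a]
  linear_combination (partialDeriv i ψ x * kronecker a j
      + partialDeriv j ψ x * kronecker a i
      - partialDeriv a ψ x * kronecker i j) * he

/-- The `ΓΓ` part of the Ricci tensor, isolated as algebra in the vector `w = ∇ψ`. -/
theorem christoffel_quadratic (w : Fin n → ℝ) (i j : Fin n) :
    (∑ a, ∑ l, ((w a * kronecker a l + w l * kronecker a a - w a * kronecker a l)
        * (w i * kronecker l j + w j * kronecker l i - w l * kronecker i j)
      - (w j * kronecker a l + w l * kronecker a j - w a * kronecker j l)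
        * (w i * kronecker l a + w a * kronecker l i - w l * kronecker i a))) =
      (n - 2) * (w i * w j - (∑ l, w l ^ 2) * kronecker i j) := by
  have key : ∀ a, ∑ l, ((w a * kronecker a l + w l * kronecker a a - w a * kronecker a l)
        * (w i * kronecker l j + w j * kronecker l i - w l * kronecker i j)
      - (w j * kronecker a l + w l * kronecker a j - w a * kronecker j l)
        * (w i * kronecker l a + w a * kronecker l i - w l * kronecker i a)) =
      w i * w j - (∑ l, w l ^ 2) * kronecker i j + w a ^ 2 * kronecker i j
      + ((∑ l, w l ^ 2) * kronecker i a - w a * w i) * kronecker a j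
      - w j * w a * kronecker a i := by
    intro a
    -- Regrouped so that each Kronecker symbol to be contracted over `l` is a trailing factor, as
    -- `sum_mul_kronecker` requires.
    have e : ∀ l, ((w a * kronecker a l + w l * kronecker a a - w a * kronecker a l)
        * (w i * kronecker l j + w j * kronecker l i - w l * kronecker i j)
      - (w j * kronecker a l + w l * kronecker a j - w a * kronecker j l)
        * (w i * kronecker l a + w a * kronecker l i - w l * kronecker i a)) =
        w l * w i * kronecker l j + (w l * w j - w l * kronecker a j * w a
            + w a ^ 2 * kronecker l j) * kronecker l i
          - w l ^ 2 * (kronecker i j - kronecker a j * kronecker i a)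
          + (-(w i * w j * kronecker l a) - w j * w a * kronecker l i + w j * w l * kronecker i a
            - w l * kronecker a j * w i + w a * w i * kronecker l j) * kronecker l a
          - w a * w l * kronecker i a * kronecker l j := by
      intro l
      rw [kronecker_self, kronecker_comm a l, kronecker_comm j l]
      ring
    simp_rw [e]
    rw [Finset.sum_sub_distrib, Finset.sum_add_distrib, Finset.sum_sub_distrib,
      Finset.sum_add_distrib]
    simp only [sum_mul_kronecker, ← Finset.sum_mul, kronecker_self]
    rw [kronecker_comm a i]
    ring
  simp_rw [key]
  rw [Finset.sum_sub_distrib, Finset.sum_add_distrib, Finset.sum_add_distrib, sum_mul_kronecker,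
    sum_mul_kronecker, ← Finset.sum_mul]
  simp only [Finset.sum_const, Finset.card_univ, Fintype.card_fin, nsmul_eq_mul]
  ring

theorem ricci_expMetric (hψ : ContDiff ℝ ∞ ψ) (x : EuclideanSpace ℝ (Fin n)) (i j : Fin n) :
    ricci (expMetric ψ) x i j =
      -((n : ℝ) - 2) * (partialDeriv i (partialDeriv j ψ) x
        - partialDeriv i ψ x * partialDeriv j ψ x)
      - (∑ l, partialDeriv l (partialDeriv l ψ) x + (n - 2) * gradSq ψ x)
        * kronecker i j := by
  have hd : ∀ a, DifferentiableAt ℝ (partialDeriv a ψ) x := fun a =>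
    ((contDiff_partialDeriv hψ a).differentiable (by simp)).differentiableAt
  have hp : ∀ b a i j, partialDeriv b (christoffel (expMetric ψ) a i j) x =
      partialDeriv b (partialDeriv i ψ) x * kronecker a j
      + partialDeriv b (partialDeriv j ψ) x * kronecker a i
      - partialDeriv b (partialDeriv a ψ) x * kronecker i j := by
    intro b a i j
    rw [christoffel_expMetric hψ]
    refine (partialDeriv_sub (((hd i).mul_const _).add ((hd j).mul_const _))
      ((hd a).mul_const _) b).trans ?_
    rw [partialDeriv_mul_const (hd a), ← partialDeriv_mul_const (hd i),
      ← partialDeriv_mul_const (hd j)]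
    rw [← partialDeriv_add ((hd i).mul_const _) ((hd j).mul_const _)]
    rfl
  have hquad := christoffel_quadratic (fun l => partialDeriv l ψ x) i j
  have hlin : ∑ a, ((partialDeriv a (partialDeriv i ψ) x * kronecker a j
      + partialDeriv a (partialDeriv j ψ) x * kronecker a i
      - partialDeriv a (partialDeriv a ψ) x * kronecker i j) -
      (partialDeriv j (partialDeriv i ψ) x * kronecker a a
      + partialDeriv j (partialDeriv a ψ) x * kronecker a i
      - partialDeriv j (partialDeriv a ψ) x * kronecker i a)) =
      -((n : ℝ) - 2) * partialDeriv i (partialDeriv j ψ) x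
      - (∑ l, partialDeriv l (partialDeriv l ψ) x) * kronecker i j := by
    simp only [Finset.sum_add_distrib, Finset.sum_sub_distrib, ← Finset.sum_mul,
      kronecker_comm i _, sum_mul_kronecker, kronecker_self, Finset.sum_const,
      Finset.card_univ, Fintype.card_fin, nsmul_eq_mul]
    rw [partialDeriv_comm hψ j i]
    ring
  simp only [ricci, Matrix.of_apply, hp]
  simp only [christoffel_expMetric hψ]
  rw [Finset.sum_add_distrib, hlin, hquad, gradSq]
  ring

theorem scalarCurvature_expMetric (hψ : ContDiff ℝ ∞ ψ) (x : EuclideanSpace ℝ (Fin n)) :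
    scalarCurvature (expMetric ψ) x = Real.exp (-(2 * ψ x)) *
      (-(2 * ((n : ℝ) - 1)) * ∑ l, partialDeriv l (partialDeriv l ψ) x
        - (n - 1) * (n - 2) * gradSq ψ x) := by
  have h1 : ∀ i, ∑ j, (expMetric ψ x)⁻¹ i j * ricci (expMetric ψ) x i j =
      Real.exp (-(2 * ψ x)) * ricci (expMetric ψ) x i i := by
    intro i
    rw [← sum_mul_kronecker (fun j => Real.exp (-(2 * ψ x)) * ricci (expMetric ψ) x i j) i]
    refine Finset.sum_congr rfl fun j _ => ?_
    rw [expMetric_inv, Matrix.smul_apply, one_apply_eq_kronecker, smul_eq_mul, kronecker_comm]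
    ring
  rw [scalarCurvature, Finset.sum_congr rfl fun i _ => h1 i, ← Finset.mul_sum]
  congr 1
  simp only [ricci_expMetric hψ, kronecker_self, mul_one, Finset.sum_sub_distrib, ← Finset.mul_sum,
    Finset.sum_const, Finset.card_univ, Fintype.card_fin, nsmul_eq_mul]
  have : ∑ l, partialDeriv l ψ x * partialDeriv l ψ x = gradSq ψ x := by simp [gradSq, sq]
  rw [this]
  ring

/-- The trace term cancels the Laplacian in the Ricci tensor, and the remaining factor `n-2` divides
out. -/
theorem schouten_expMetric (hn : 3 ≤ n) (hψ : ContDiff ℝ ∞ ψ) (x : EuclideanSpace ℝ (Fin n)) :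
    schouten (expMetric ψ) x = expSchouten ψ x := by
  ext i j
  have hn' : (3 : ℝ) ≤ n := by exact_mod_cast hn
  have h1 : (n : ℝ) - 2 ≠ 0 := by linarith
  have h2 : (n : ℝ) - 1 ≠ 0 := by linarith
  have he : Real.exp (-(2 * ψ x)) * Real.exp (2 * ψ x) = 1 := by rw [← Real.exp_add]; simp
  simp only [schouten, expSchouten, Matrix.smul_apply, Matrix.sub_apply, Matrix.of_apply,
    smul_eq_mul, ricci_expMetric hψ, scalarCurvature_expMetric hψ, expMetric, one_apply_eq_kronecker]
  rw [mul_comm (Real.exp (-(2 * ψ x)))]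
  set L := ∑ l, partialDeriv l (partialDeriv l ψ) x
  have : ∀ c : ℝ, (-(2 * ((n : ℝ) - 1)) * L - (n - 1) * (n - 2) * gradSq ψ x) *
      Real.exp (-(2 * ψ x)) / (2 * (n - 1)) * (Real.exp (2 * ψ x) * c) =
      (-L - (n - 2) * gradSq ψ x / 2) * c := by
    intro c
    have : (-(2 * ((n : ℝ) - 1)) * L - (n - 1) * (n - 2) * gradSq ψ x) *
      Real.exp (-(2 * ψ x)) / (2 * (n - 1)) * (Real.exp (2 * ψ x) * c) =
      (-(2 * ((n : ℝ) - 1)) * L - (n - 1) * (n - 2) * gradSq ψ x) / (2 * (n - 1)) * c *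
      (Real.exp (-(2 * ψ x)) * Real.exp (2 * ψ x)) := by ring
    rw [this, he]
    field_simp
  rw [this]
  field_simp
  ring

/-- With `hessian_sub_exp_neg`, this shows that admissibility and the equation concern the same
matrix up to positive scalars. -/
theorem inv_mul_schouten_expMetric (hn : 3 ≤ n) (hψ : ContDiff ℝ ∞ ψ)
    (x : EuclideanSpace ℝ (Fin n)) :
    (expMetric ψ x)⁻¹ * schouten (expMetric ψ) x = Real.exp (-(2 * ψ x)) • expSchouten ψ x := by
  rw [schouten_expMetric hn hψ, expMetric_inv, Matrix.smul_mul, Matrix.one_mul]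

theorem norm_gradient_sq (f : EuclideanSpace ℝ (Fin n) → ℝ) (x : EuclideanSpace ℝ (Fin n)) :
    ‖gradient f x‖ ^ 2 = gradSq f x := by
  rw [EuclideanSpace.norm_sq_eq, gradSq]
  refine Finset.sum_congr rfl fun l _ => ?_
  rw [partialDeriv, Real.norm_eq_abs, sq_abs, ← toDual_gradient, InnerProductSpace.toDual_apply_apply,
    EuclideanSpace.inner_single_right]
  simp

/-- The matrix of the soliton equation for `v = e^{-ψ}`. -/
theorem hessian_sub_exp_neg (hψ : ContDiff ℝ ∞ ψ) (x : EuclideanSpace ℝ (Fin n)) :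
    hessian (fun y => Real.exp (-ψ y)) x -
      (‖gradient (fun y => Real.exp (-ψ y)) x‖ ^ 2 / (2 * Real.exp (-ψ x))) •
        (1 : Matrix (Fin n) (Fin n) ℝ) = Real.exp (-ψ x) • expSchouten ψ x := by
  have hd : ∀ y, DifferentiableAt ℝ ψ y := fun y => (hψ.differentiable (by simp)).differentiableAt
  have hd2 : ∀ a y, DifferentiableAt ℝ (partialDeriv a ψ) y := fun a y =>
    ((contDiff_partialDeriv hψ a).differentiable (by simp)).differentiableAt
  have hE : ∀ y, HasDerivAt (fun s => Real.exp (-s)) (Real.exp (-ψ y) * -1) (ψ y) := fun y =>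
    ((hasDerivAt_id (ψ y)).neg).exp
  have h1 : ∀ j, partialDeriv j (fun y => Real.exp (-ψ y)) =
      fun y => (-Real.exp (-ψ y)) * partialDeriv j ψ y := by
    intro j; funext y
    rw [partialDeriv_comp (hE y) (hd y)]; ring
  have h2 : ∀ i y, partialDeriv i (fun y => -Real.exp (-ψ y)) y =
      Real.exp (-ψ y) * partialDeriv i ψ y := by
    intro i y
    rw [partialDeriv_comp (φ := fun s => -Real.exp (-s)) (hE y).neg (hd y)]; ring
  ext i j
  rw [norm_gradient_sq]
  simp only [hessian, expSchouten, gradSq, Matrix.sub_apply, Matrix.of_apply, Matrix.smul_apply,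
    smul_eq_mul, one_apply_eq_kronecker, h1]
  have h3 : DifferentiableAt ℝ (fun y => -Real.exp (-ψ y)) x := (hd x).neg.exp.neg
  rw [partialDeriv_mul h3 (hd2 j x), h2]
  simp only [neg_mul, neg_sq, mul_pow, ← Finset.mul_sum]
  have hpos := (Real.exp_pos (-ψ x)).ne'
  field_simp

end Conformal
end KYamabe

/-! ### Radial functions and reduction to the ODE -/

namespace KYamabe

section Sigma

theorem sigma_diagonal {n : ℕ} (j : ℕ) (d : Fin n → ℝ) :
    sigma j (Matrix.diagonal d) = (Finset.univ.val.map d).esymm j := by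
  rw [sigma, Matrix.charpoly_diagonal]
  have := Polynomial.roots_multiset_prod_X_sub_C (Finset.univ.val.map d)
  rw [Multiset.map_map] at this
  exact congrArg (fun s => Multiset.esymm s j) this

theorem esymm_replicate (N j : ℕ) (a : ℝ) :
    (Multiset.replicate N a).esymm j = N.choose j * a ^ j := by
  rw [Multiset.esymm]
  have : (Multiset.powersetCard j (Multiset.replicate N a)).map Multiset.prod =
      Multiset.replicate (N.choose j) (a ^ j) := by
    rw [Multiset.eq_replicate]
    constructor
    · simp
    · intro b hb
      obtain ⟨s, hs, rfl⟩ := Multiset.mem_map.1 hb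
      obtain ⟨hs1, hs2⟩ := Multiset.mem_powersetCard.1 hs
      obtain ⟨m, -, rfl⟩ := Multiset.le_replicate_iff.1 hs1
      rw [Multiset.card_replicate] at hs2
      rw [Multiset.prod_replicate, hs2]
  rw [this, Multiset.sum_replicate, nsmul_eq_mul]

theorem esymm_cons (j : ℕ) (b : ℝ) (s : Multiset ℝ) :
    (b ::ₘ s).esymm (j + 1) = s.esymm (j + 1) + b * s.esymm j := by
  simp only [Multiset.esymm, Multiset.powersetCard_cons, Multiset.map_add, Multiset.sum_add,
    Multiset.map_map, Function.comp_def, Multiset.prod_cons, Multiset.sum_map_mul_left]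

/-- A diagonal matrix whose entries are all equal except possibly one. -/
theorem sigma_diagonal_update {n : ℕ} (j : ℕ) (i₀ : Fin n) (a b : ℝ) :
    sigma (j + 1) (Matrix.diagonal fun i => if i = i₀ then b else a) =
      (n - 1).choose (j + 1) * a ^ (j + 1) + b * ((n - 1).choose j * a ^ j) := by
  have : (Finset.univ.val.map fun i : Fin n => if i = i₀ then b else a) =
      b ::ₘ Multiset.replicate (n - 1) a := by
    rw [← Finset.insert_erase (Finset.mem_univ i₀),
      Finset.insert_val_of_notMem (Finset.notMem_erase i₀ _), Multiset.map_cons, if_pos rfl]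
    congr 1
    rw [Multiset.eq_replicate]
    constructor
    · rw [Multiset.card_map, Finset.card_val, Finset.card_erase_of_mem (Finset.mem_univ _)]
      simp
    · intro c hc
      obtain ⟨i, hi, rfl⟩ := Multiset.mem_map.1 hc
      exact if_neg (Finset.ne_of_mem_erase (show i ∈ Finset.univ.erase i₀ from hi))
  rw [sigma_diagonal, this, esymm_cons, esymm_replicate, esymm_replicate]

end Sigma

section Radial

variable {n : ℕ} {ψ : EuclideanSpace ℝ (Fin n) → ℝ}

theorem hasDerivAt_add_single {f : EuclideanSpace ℝ (Fin n) → ℝ} (hf : ContDiff ℝ ∞ f)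
    (x : EuclideanSpace ℝ (Fin n)) (i : Fin n) (s : ℝ) :
    HasDerivAt (fun s => f (x + EuclideanSpace.single i s))
      (partialDeriv i f (x + EuclideanSpace.single i s)) s := by
  have h1 : HasDerivAt (fun s : ℝ => x + s • EuclideanSpace.single i (1 : ℝ))
      ((1 : ℝ) • EuclideanSpace.single i (1 : ℝ)) s :=
    ((hasDerivAt_id s).smul_const _).const_add x
  have h2 : ∀ s : ℝ, s • EuclideanSpace.single i (1 : ℝ) = EuclideanSpace.single i s := by
    intro s; ext l; simp
  simp only [h2] at h1
  have h3 := ((hf.differentiable (by simp)) (x + EuclideanSpace.single i s)).hasFDerivAt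
  exact h3.comp_hasDerivAt s h1

theorem norm_add_single_sq (x : EuclideanSpace ℝ (Fin n)) (i : Fin n) (s : ℝ) :
    ‖x + EuclideanSpace.single i s‖ ^ 2 = ‖x‖ ^ 2 + 2 * (s * x i) + s ^ 2 := by
  rw [norm_add_sq_real, EuclideanSpace.inner_single_right]
  simp

/-- Reflection in the `j`-th coordinate fixes `x` and preserves `ψ`, so the derivative equals its
own negative. -/
theorem partialDeriv_eq_zero (hψ : ContDiff ℝ ∞ ψ) (hrad : ∀ x y, ‖x‖ = ‖y‖ → ψ x = ψ y)
    {x : EuclideanSpace ℝ (Fin n)} {j : Fin n} (hx : x j = 0) : partialDeriv j ψ x = 0 := by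
  have h1 := hasDerivAt_add_single hψ x j 0
  have h2 : HasDerivAt (fun s => ψ (x + EuclideanSpace.single j (-s)))
      (partialDeriv j ψ (x + EuclideanSpace.single j (-0)) * -1) 0 :=
    (hasDerivAt_add_single hψ x j (-0)).comp (0 : ℝ) (hasDerivAt_neg 0)
  have h3 : (fun s => ψ (x + EuclideanSpace.single j (-s))) =
      fun s => ψ (x + EuclideanSpace.single j s) := by
    funext s
    apply hrad
    rw [← sq_eq_sq₀ (norm_nonneg _) (norm_nonneg _), norm_add_single_sq, norm_add_single_sq, hx]
    ring
  rw [h3] at h2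
  have := h1.unique h2
  have e : x + EuclideanSpace.single j (0 : ℝ) = x := by ext l; simp
  rw [neg_zero, e] at this
  linarith

theorem partialDeriv_partialDeriv_eq_zero (hψ : ContDiff ℝ ∞ ψ)
    (hrad : ∀ x y, ‖x‖ = ‖y‖ → ψ x = ψ y) {x : EuclideanSpace ℝ (Fin n)} {i j : Fin n}
    (hij : i ≠ j) (hx : x j = 0) : partialDeriv i (partialDeriv j ψ) x = 0 := by
  have h1 := hasDerivAt_add_single (contDiff_partialDeriv hψ j) x i 0
  have h2 : (fun s => partialDeriv j ψ (x + EuclideanSpace.single i s)) = fun _ => 0 := by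
    funext s
    apply partialDeriv_eq_zero hψ hrad
    simp [hx, hij.symm]
  rw [h2] at h1
  have := h1.unique (hasDerivAt_const _ _)
  have e : x + EuclideanSpace.single i (0 : ℝ) = x := by ext l; simp
  rwa [e] at this

theorem hasDerivAt_single {f : EuclideanSpace ℝ (Fin n) → ℝ} (hf : ContDiff ℝ ∞ f) (i : Fin n)
    (r : ℝ) : HasDerivAt (fun s => f (EuclideanSpace.single i s))
      (partialDeriv i f (EuclideanSpace.single i r)) r := by
  simpa using hasDerivAt_add_single hf 0 i r

/-- Along `x + s eⱼ`, `∂ⱼψ` is `s` times a function differentiable at `0`; its derivative at `s = 0`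
is that function's value. -/
theorem partialDeriv_partialDeriv_angular (hψ : ContDiff ℝ ∞ ψ)
    (hrad : ∀ x y, ‖x‖ = ‖y‖ → ψ x = ψ y) {i j : Fin n} (hij : j ≠ i) {r : ℝ} (hr : 0 < r) :
    partialDeriv j (partialDeriv j ψ) (EuclideanSpace.single i r) =
      partialDeriv i ψ (EuclideanSpace.single i r) / r := by
  set x : EuclideanSpace ℝ (Fin n) := EuclideanSpace.single i r with hx
  have hpos : ∀ s : ℝ, 0 < r ^ 2 + s ^ 2 := fun s => by positivity
  have hval : ∀ s, ψ (x + EuclideanSpace.single j s) =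
      ψ (EuclideanSpace.single i (√(r ^ 2 + s ^ 2))) := by
    intro s
    apply hrad
    rw [← sq_eq_sq₀ (norm_nonneg _) (norm_nonneg _), norm_add_single_sq]
    simp [hx, hij, Real.sq_sqrt (hpos s).le]
  have hsq : ∀ s, HasDerivAt (fun s => √(r ^ 2 + s ^ 2)) (s / √(r ^ 2 + s ^ 2)) s := by
    intro s
    have := ((hasDerivAt_pow 2 s).const_add (r ^ 2)).sqrt (hpos s).ne'
    refine this.congr_deriv ?_
    have := (Real.sqrt_pos.2 (hpos s)).ne'
    field_simp
    simp
  have hder : (fun s => partialDeriv j ψ (x + EuclideanSpace.single j s)) = fun s =>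
      s * (partialDeriv i ψ (EuclideanSpace.single i (√(r ^ 2 + s ^ 2))) / √(r ^ 2 + s ^ 2)) := by
    funext s
    have h1 := hasDerivAt_add_single hψ x j s
    have h2 := (hasDerivAt_single hψ i (√(r ^ 2 + s ^ 2))).comp s (hsq s)
    simp only [hval] at h1
    rw [h1.unique h2]
    ring
  have h1 := hasDerivAt_add_single (contDiff_partialDeriv hψ j) x j 0
  have h2 : DifferentiableAt ℝ (fun s : ℝ =>
      partialDeriv i ψ (EuclideanSpace.single i (√(r ^ 2 + s ^ 2))) / √(r ^ 2 + s ^ 2)) 0 :=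
    DifferentiableAt.fun_div (HasDerivAt.differentiableAt
      (((hasDerivAt_single (contDiff_partialDeriv hψ i) i (√(r ^ 2 + 0 ^ 2)))).comp (0 : ℝ) (hsq 0) :)) (hsq 0).differentiableAt
      (Real.sqrt_pos.2 (hpos 0)).ne'
  rw [hder] at h1
  have h3 := h1.unique ((hasDerivAt_id (0 : ℝ)).mul h2.hasDerivAt)
  have e : x + EuclideanSpace.single j (0 : ℝ) = x := by ext l; simp
  rw [e] at h3
  rw [h3]
  simp [Real.sqrt_sq hr.le, hx]

theorem gradSq_axis (hψ : ContDiff ℝ ∞ ψ) (hrad : ∀ x y, ‖x‖ = ‖y‖ → ψ x = ψ y) (i : Fin n)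
    (r : ℝ) : gradSq ψ (EuclideanSpace.single i r) =
      partialDeriv i ψ (EuclideanSpace.single i r) ^ 2 := by
  rw [gradSq, Finset.sum_eq_single i]
  · intro l _ hl
    rw [partialDeriv_eq_zero hψ hrad (by simp [hl])]
    simp
  · simp

theorem expSchouten_axis (hψ : ContDiff ℝ ∞ ψ) (hrad : ∀ x y, ‖x‖ = ‖y‖ → ψ x = ψ y) (i₀ : Fin n)
    {r : ℝ} (hr : 0 < r) (c : ℝ) : c • expSchouten ψ (EuclideanSpace.single i₀ r) =
      Matrix.diagonal fun i => if i = i₀ then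
        c * (-partialDeriv i₀ (partialDeriv i₀ ψ) (EuclideanSpace.single i₀ r)
          + partialDeriv i₀ ψ (EuclideanSpace.single i₀ r) ^ 2 / 2)
      else c * (-(partialDeriv i₀ ψ (EuclideanSpace.single i₀ r) / r)
          - partialDeriv i₀ ψ (EuclideanSpace.single i₀ r) ^ 2 / 2) := by
  ext i j
  rw [Matrix.smul_apply, expSchouten, Matrix.of_apply, gradSq_axis hψ hrad, smul_eq_mul]
  rcases eq_or_ne i j with rfl | hij
  · rw [Matrix.diagonal_apply_eq, kronecker_self]
    split_ifs with h
    · subst h; ring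
    · rw [partialDeriv_partialDeriv_angular hψ hrad h hr,
        partialDeriv_eq_zero hψ hrad (j := i) (by simp [h])]
      ring
  · rw [Matrix.diagonal_apply_ne _ hij, kronecker, if_neg hij]
    have h1 : partialDeriv i (partialDeriv j ψ) (EuclideanSpace.single i₀ r) = 0 := by
      by_cases hj : j = i₀
      · subst hj
        rw [partialDeriv_comm hψ]
        exact partialDeriv_partialDeriv_eq_zero hψ hrad hij.symm (by simp [hij])
      · exact partialDeriv_partialDeriv_eq_zero hψ hrad hij (by simp [hj])
    have h2 : partialDeriv i ψ (EuclideanSpace.single i₀ r) *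
        partialDeriv j ψ (EuclideanSpace.single i₀ r) = 0 := by
      by_cases hj : j = i₀
      · rw [partialDeriv_eq_zero hψ hrad (j := i) (by simp [hj ▸ hij]), zero_mul]
      · rw [partialDeriv_eq_zero hψ hrad (j := j) (by simp [hj]), mul_zero]
    rw [h1, h2]
    simp

end Radial

section Cylinder

variable {n k : ℕ} {ψ : EuclideanSpace ℝ (Fin n) → ℝ}

/-- Positive scalar curvature forces a radial conformal factor to decrease. -/
theorem radial_deriv_neg (hn : 3 ≤ n) (hψ : ContDiff ℝ ∞ ψ)
    (hrad : ∀ x y, ‖x‖ = ‖y‖ → ψ x = ψ y) (i₀ : Fin n)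
    (hadm : ∀ x, 0 < sigma 1 (Real.exp (-(2 * ψ x)) • expSchouten ψ x)) {r : ℝ} (hr : 0 < r) :
    partialDeriv i₀ ψ (EuclideanSpace.single i₀ r) < 0 := by
  set P := fun r => partialDeriv i₀ ψ (EuclideanSpace.single i₀ r) with hP
  set Q := fun r => partialDeriv i₀ (partialDeriv i₀ ψ) (EuclideanSpace.single i₀ r) with hQ
  have hn' : (3 : ℝ) ≤ n := by exact_mod_cast hn
  have hd : ∀ s, HasDerivAt (fun s => s ^ (n - 1) * P s)
      (((n - 1 : ℕ) : ℝ) * s ^ (n - 1 - 1) * P s + s ^ (n - 1) * Q s) s := fun s =>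
    (hasDerivAt_pow (n - 1) s).mul (hasDerivAt_single (contDiff_partialDeriv hψ i₀) i₀ s)
  -- The inequality `σ₁ > 0` reads `(n-1)P/s + Q < -((n-2)/2) P² ≤ 0`, so `s^(n-1) P`, zero at the
  -- origin, strictly decreases.
  have hanti : StrictAntiOn (fun s => s ^ (n - 1) * P s) (Set.Ici 0) := by
    refine strictAntiOn_of_deriv_neg (convex_Ici 0)
      (fun s _ => (hd s).continuousAt.continuousWithinAt) fun s hs => ?_
    rw [interior_Ici, Set.mem_Ioi] at hs
    rw [(hd s).deriv]
    have h1 := hadm (EuclideanSpace.single i₀ s)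
    rw [expSchouten_axis hψ hrad i₀ hs, sigma_diagonal_update] at h1
    change 0 < _ * (Real.exp _ * (-(P s / s) - P s ^ 2 / 2)) ^ 1 +
      Real.exp _ * (-Q s + P s ^ 2 / 2) * _ at h1
    simp only [zero_add, Nat.choose_one_right, pow_one, Nat.choose_zero_right, pow_zero,
      Nat.cast_one, mul_one] at h1
    rw [Nat.cast_sub (by omega), Nat.cast_one] at h1 ⊢
    set E := Real.exp (-(2 * ψ (EuclideanSpace.single i₀ s)))
    have hE : 0 < E := Real.exp_pos _
    have h2 : 0 < ((n : ℝ) - 1) * (-(P s / s) - P s ^ 2 / 2) + (-Q s + P s ^ 2 / 2) := by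
      refine (pos_iff_pos_of_mul_pos (?_ : 0 < E * _)).1 hE
      linarith
    have h3 : ((n : ℝ) - 1) * (P s / s) + Q s < 0 := by nlinarith [sq_nonneg (P s)]
    have h4 : ((n : ℝ) - 1) * s ^ (n - 1 - 1) * P s + s ^ (n - 1) * Q s =
        s ^ (n - 1) * (((n : ℝ) - 1) * (P s / s) + Q s) := by
      have : s ^ (n - 1) = s ^ (n - 1 - 1) * s := by rw [← pow_succ]; congr 1; omega
      rw [this]
      field_simp
    rw [h4]
    exact mul_neg_of_pos_of_neg (by positivity) h3
  have := hanti (Set.mem_Ici.2 le_rfl) (Set.mem_Ici.2 hr.le) hr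
  simp only [zero_pow (by omega : n - 1 ≠ 0), zero_mul] at this
  exact (pos_iff_neg_of_mul_neg this).1 (by positivity)

/-- At `r = e^t` the eigenvalues of the Schouten matrix are `a/r²` (tangential) and `(-q'-a)/r²`
(radial). The ratio of the two binomials is `(n-k)/k`; subtracting the `1` from the radial `-a`
leaves `(n-2k)/k`. -/
theorem cylindricalSoliton_of_radial {θ ρ : ℝ} (hn : 3 ≤ n) (hk : 1 ≤ k) (hnk : 2 * k ≤ n)
    (hθ : 0 < θ) (hψ : ContDiff ℝ ∞ ψ) (hrad : ∀ x y, ‖x‖ = ‖y‖ → ψ x = ψ y) (i₀ : Fin n)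
    (hadm : ∀ x j, 1 ≤ j → j ≤ k → 0 < sigma j (Real.exp (-(2 * ψ x)) • expSchouten ψ x))
    (heq : ∀ x, sigma k (Real.exp (-ψ x) • expSchouten ψ x) ^ (1 / k : ℝ) =
      Real.exp (ψ x) * (2 * θ + ρ + 2 * θ * fderiv ℝ ψ x x)) :
    CylindricalSoliton n k θ ρ (1 / (n - 1).choose (k - 1))
      (fun t => ψ (EuclideanSpace.single i₀ (Real.exp t)) + t)
      (fun t => partialDeriv i₀ ψ (EuclideanSpace.single i₀ (Real.exp t)) * Real.exp t + 1)
      (fun t => partialDeriv i₀ (partialDeriv i₀ ψ) (EuclideanSpace.single i₀ (Real.exp t))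
          * Real.exp t * Real.exp t
        + partialDeriv i₀ ψ (EuclideanSpace.single i₀ (Real.exp t)) * Real.exp t) := by
  set F := fun r => ψ (EuclideanSpace.single i₀ r) with hF
  set P := fun r => partialDeriv i₀ ψ (EuclideanSpace.single i₀ r) with hP
  set Q := fun r => partialDeriv i₀ (partialDeriv i₀ ψ) (EuclideanSpace.single i₀ r) with hQ
  have dF : ∀ r, HasDerivAt F (P r) r := hasDerivAt_single hψ i₀
  have dP : ∀ r, HasDerivAt P (Q r) r := hasDerivAt_single (contDiff_partialDeriv hψ i₀) i₀
  have hC : 0 < ((n - 1).choose (k - 1) : ℝ) := by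
    exact_mod_cast Nat.choose_pos (by omega)
  have hk0 : (0 : ℝ) < k := by exact_mod_cast hk
  have hchoose : ((n - 1).choose k : ℝ) * k = (n - 1).choose (k - 1) * (n - k) := by
    have := Nat.choose_succ_right_eq (n - 1) (k - 1)
    rw [Nat.sub_add_cancel hk, show n - 1 - (k - 1) = n - k by omega] at this
    rw [← Nat.cast_sub (by omega)]
    exact_mod_cast this
  have hexp0 : Tendsto Real.exp atBot (nhds 0) := Real.tendsto_exp_atBot
  have key : ∀ r, 0 < r → 0 < ρ + 2 * θ * (P r * r + 1) ∧
      (n - 1).choose k * (-(P r / r) - P r ^ 2 / 2) ^ k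
        + (-Q r + P r ^ 2 / 2) * ((n - 1).choose (k - 1) * (-(P r / r) - P r ^ 2 / 2) ^ (k - 1)) =
      Real.exp (2 * k * F r) * (ρ + 2 * θ * (P r * r + 1)) ^ k := by
    intro r hr
    have hs : ∀ c, sigma k (c • expSchouten ψ (EuclideanSpace.single i₀ r)) =
        c ^ k * ((n - 1).choose k * (-(P r / r) - P r ^ 2 / 2) ^ k
        + (-Q r + P r ^ 2 / 2) *
          ((n - 1).choose (k - 1) * (-(P r / r) - P r ^ 2 / 2) ^ (k - 1))) := by
      intro c
      have := sigma_diagonal_update (k - 1) i₀ (c * (-(P r / r) - P r ^ 2 / 2))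
        (c * (-Q r + P r ^ 2 / 2))
      rw [Nat.sub_add_cancel hk] at this
      rw [expSchouten_axis hψ hrad i₀ hr, this]
      obtain ⟨j, rfl⟩ : ∃ j, k = j + 1 := ⟨k - 1, by omega⟩
      simp only [Nat.add_sub_cancel, mul_pow, pow_succ]
      ring
    have h1 := hadm (EuclideanSpace.single i₀ r) k hk le_rfl
    have h2 := heq (EuclideanSpace.single i₀ r)
    rw [hs] at h1 h2
    set T := (n - 1).choose k * (-(P r / r) - P r ^ 2 / 2) ^ k
        + (-Q r + P r ^ 2 / 2) * ((n - 1).choose (k - 1) * (-(P r / r) - P r ^ 2 / 2) ^ (k - 1))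
    have hT : 0 < T := (pos_iff_pos_of_mul_pos h1).1 (by positivity)
    have h3 : fderiv ℝ ψ (EuclideanSpace.single i₀ r) (EuclideanSpace.single i₀ r) = P r * r := by
      have : (EuclideanSpace.single i₀ r : EuclideanSpace ℝ (Fin n)) =
          r • EuclideanSpace.single i₀ (1 : ℝ) := by ext l; simp
      conv_lhs => rw [this, map_smul, ← this]
      rw [smul_eq_mul, mul_comm]
      rfl
    rw [h3, show 2 * θ + ρ + 2 * θ * (P r * r) = ρ + 2 * θ * (P r * r + 1) by ring] at h2
    change (Real.exp (-F r) ^ k * T) ^ (1 / k : ℝ) = Real.exp (F r) * _ at h2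
    have hpos : 0 < Real.exp (-F r) ^ k * T := by positivity
    -- Admissibility makes the `k`-th root positive, which fixes the sign of the right side.
    have h4 : 0 < Real.exp (F r) * (ρ + 2 * θ * (P r * r + 1)) := h2 ▸ Real.rpow_pos_of_pos hpos _
    refine ⟨(pos_iff_pos_of_mul_pos h4).1 (Real.exp_pos _), ?_⟩
    have h5 : Real.exp (-F r) ^ k * T = (Real.exp (F r) * (ρ + 2 * θ * (P r * r + 1))) ^ k := by
      rw [← h2, ← Real.rpow_natCast (_ ^ (1 / k : ℝ)), ← Real.rpow_mul hpos.le,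
        one_div_mul_cancel hk0.ne', Real.rpow_one]
    rw [mul_pow, Real.exp_neg, inv_pow, inv_mul_eq_iff_eq_mul₀ (by positivity), ← mul_assoc,
      ← mul_pow, ← Real.exp_add, ← Real.exp_nat_mul] at h5
    rw [h5]
    congr 2
    ring
  refine
    { hk := hk
      hnk := hnk
      hθ := hθ
      hD := by positivity
      deriv_y := fun t => ((dF _).comp t (Real.hasDerivAt_exp t)).add (hasDerivAt_id t)
      deriv_q := fun t => (((dP _).comp t (Real.hasDerivAt_exp t)).mul
        (Real.hasDerivAt_exp t)).add_const 1
      pos := fun t => (key _ (Real.exp_pos t)).1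
      lt_one := fun t => ?_
      eqn := fun t => ?_
      tendsto_y := ?_
      tendsto_q := ?_ }
  · have := radial_deriv_neg hn hψ hrad i₀ (fun x => hadm x 1 le_rfl hk) (Real.exp_pos t)
    have := mul_neg_of_neg_of_pos this (Real.exp_pos t)
    linarith
  · have h1 := (key _ (Real.exp_pos t)).2
    have hr := Real.exp_pos t
    have e0 : Real.exp (2 * k * (F (Real.exp t) + t)) =
        Real.exp (2 * k * F (Real.exp t)) * (Real.exp t ^ 2) ^ k := by
      rw [← pow_mul, ← Real.exp_nat_mul, ← Real.exp_add]; push_cast; congr 1; ring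
    set r := Real.exp t
    set q := P r * r + 1
    have ea : -(P r / r) - P r ^ 2 / 2 = (1 - q ^ 2) / 2 / r ^ 2 := by
      simp only [q]; field_simp; ring
    have eb : -Q r + P r ^ 2 / 2 = (-(Q r * r * r + P r * r) - (1 - q ^ 2) / 2) / r ^ 2 := by
      simp only [q]; field_simp; ring
    rw [ea, eb] at h1
    set a := (1 - q ^ 2) / 2
    set q' := Q r * r * r + P r * r
    change a ^ (k - 1) * (((n : ℝ) - 2 * k) / k * a - q') =
      1 / ((n - 1).choose (k - 1) : ℝ) * Real.exp (2 * k * (F r + t)) * (ρ + 2 * θ * q) ^ k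
    clear_value a q' q
    rw [e0, mul_assoc, mul_right_comm (Real.exp _), ← h1]
    have hr2 : r ^ 2 ≠ 0 := by positivity
    have e1 : a ^ k = a ^ (k - 1) * a := by rw [← pow_succ, Nat.sub_add_cancel hk]
    have e2 : (r ^ 2) ^ k = (r ^ 2) ^ (k - 1) * r ^ 2 := by
      rw [← pow_succ, Nat.sub_add_cancel hk]
    have e3 : ((n - 1).choose k : ℝ) = (n - 1).choose (k - 1) * (n - k) / k := by
      rw [← hchoose]; field_simp
    rw [div_pow, div_pow, e1, e2, e3]
    have hr3 : (r ^ 2) ^ (k - 1) ≠ 0 := by positivity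
    generalize (r ^ 2) ^ (k - 1) = R at hr3
    generalize a ^ (k - 1) = A
    field_simp
    ring
  · have h1 : Tendsto (fun t => F (Real.exp t)) atBot (nhds (F 0)) :=
      (dF 0).continuousAt.tendsto.comp hexp0
    exact h1.add_atBot tendsto_id
  · have h1 : Tendsto (fun t => P (Real.exp t)) atBot (nhds (P 0)) :=
      (dP 0).continuousAt.tendsto.comp hexp0
    simpa using (h1.mul hexp0).add_const 1

end Cylinder

end KYamabe

/-! ### From the soliton to the ODE, and back to decay of `u` -/

namespace KYamabe

section Soliton

variable {n k : ℕ} {θ ρ : ℝ} {u : EuclideanSpace ℝ (Fin n) → ℝ}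

theorem fderiv_apply_eq_inner_gradient (f : EuclideanSpace ℝ (Fin n) → ℝ)
    (x z : EuclideanSpace ℝ (Fin n)) : inner ℝ z (gradient f x) = fderiv ℝ f x z := by
  rw [real_inner_comm, ← toDual_gradient, InnerProductSpace.toDual_apply_apply]

/-- In logarithmic polar coordinates a radial soliton is governed by a `CylindricalSoliton`. -/
theorem IsRadialSoliton.exists_cylindricalSoliton (hu : IsRadialSoliton k θ ρ u) (hn : 3 ≤ n)
    (hk : 1 ≤ k) (hnk : 2 * k ≤ n) (hθ : 0 < θ) :
    ∃ D y q q', CylindricalSoliton n k θ ρ D y q q' ∧ ∀ x, x ≠ 0 →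
      u x = Real.exp ((y (Real.log ‖x‖) - Real.log ‖x‖) * ((n + 2 * k) / (2 * k))) := by
  have hk0 : (0 : ℝ) < k := by exact_mod_cast hk
  have hn0 : (0 : ℝ) < n := by exact_mod_cast (by omega : 0 < n)
  -- With `ψ = c log u` one has `g = e^{2ψ}|dx|²` and `v = e^{-ψ}` at once.
  obtain ⟨c, hc⟩ : ∃ c : ℝ, c = 2 * k / (n + 2 * k) := ⟨_, rfl⟩
  have hc0 : 0 < c := by rw [hc]; positivity
  set ψ : EuclideanSpace ℝ (Fin n) → ℝ := fun x => c * Real.log (u x) with hψdef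
  have hψ : ContDiff ℝ ∞ ψ :=
    contDiff_const.mul (hu.smooth.log fun x => (hu.pos x).ne')
  have hrad : ∀ x y, ‖x‖ = ‖y‖ → ψ x = ψ y := fun x y h => by
    simp only [hψdef, hu.radial x y h]
  have hmetric : conformalMetric k u = expMetric ψ := by
    funext x
    rw [conformalMetric, expMetric, Real.rpow_def_of_pos (hu.pos x)]
    congr 2
    simp only [hψdef, hc]
    ring
  have hv : (fun x => u x ^ (-(2 * k / (n + 2 * k)) : ℝ)) = fun x => Real.exp (-ψ x) := by
    funext x
    rw [Real.rpow_def_of_pos (hu.pos x), ← hc]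
    congr 1
    simp only [hψdef]
    ring
  have hadm : ∀ x j, 1 ≤ j → j ≤ k →
      0 < sigma j (Real.exp (-(2 * ψ x)) • expSchouten ψ x) := by
    intro x j h1 h2
    have := hu.admissible x j h1 h2
    rwa [hmetric, sigmaCurvature, inv_mul_schouten_expMetric hn hψ] at this
  have heq : ∀ x, sigma k (Real.exp (-ψ x) • expSchouten ψ x) ^ (1 / k : ℝ) =
      Real.exp (ψ x) * (2 * θ + ρ + 2 * θ * fderiv ℝ ψ x x) := by
    intro x
    have h1 := hu.equation
    rw [SolvesSolitonEquation] at h1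
    simp only [hv] at h1
    have h2 := h1 x
    rw [congrFun hv x, hessian_sub_exp_neg hψ, fderiv_apply_eq_inner_gradient] at h2
    rw [h2]
    have hux := hu.pos x
    have hfd : fderiv ℝ ψ x x = c * ((u x)⁻¹ * fderiv ℝ u x x) := by
      have := (((hu.smooth.differentiable (by simp)) x).hasFDerivAt.log hux.ne').const_mul c
      rw [this.fderiv]
      rfl
    have hpow : u x ^ (2 * k / (n + 2 * k) - 1 : ℝ) = Real.exp (ψ x) / u x := by
      rw [Real.rpow_sub_one hux.ne', Real.rpow_def_of_pos hux, ← hc, mul_comm]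
    rw [hfd, hpow, show (4 * k * θ / (n + 2 * k) : ℝ) = 2 * θ * c by rw [hc]; ring]
    field_simp
  have h := cylindricalSoliton_of_radial hn hk hnk hθ hψ hrad ⟨0, by omega⟩ hadm heq
  refine ⟨_, _, _, _, h, fun x hx => ?_⟩
  rw [Real.exp_log (norm_pos_iff.2 hx), add_sub_cancel_right,
    hrad (EuclideanSpace.single _ ‖x‖) x (by simp)]
  have : ψ x * ((n + 2 * k) / (2 * k)) = Real.log (u x) := by
    simp only [hψdef, hc]
    field_simp
  rw [this, Real.exp_log (hu.pos x)]

end Soliton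

section Asymptotics

variable {E : Type*} [NormedAddCommGroup E] {u : E → ℝ} {y : ℝ → ℝ} {γ : ℝ}

theorem eventually_cobounded_log (T : ℝ) :
    ∀ᶠ x : E in Bornology.cobounded E, x ≠ 0 ∧ T ≤ Real.log ‖x‖ := by
  have h1 : Tendsto (fun x : E => ‖x‖) (Bornology.cobounded E) atTop := tendsto_norm_cobounded_atTop
  filter_upwards [h1.eventually_gt_atTop 0,
    (Real.tendsto_log_atTop.comp h1).eventually_ge_atTop T] with x hx hT
  exact ⟨norm_pos_iff.1 hx, hT⟩

theorem isBigO_of_log_bound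
    (hu : ∀ x, x ≠ 0 → u x = Real.exp ((y (Real.log ‖x‖) - Real.log ‖x‖) * γ))
    {G : ℝ → ℝ} {K T : ℝ} (h : ∀ t, T ≤ t → Real.exp ((y t - t) * γ) ≤ K * G (Real.exp t)) :
    u =O[Bornology.cobounded E] fun x => G ‖x‖ := by
  refine IsBigO.of_bound |K| ?_
  filter_upwards [eventually_cobounded_log T] with x hx
  have h1 := h _ hx.2
  rw [← hu x hx.1, Real.exp_log (norm_pos_iff.2 hx.1)] at h1
  have h2 : 0 < u x := by rw [hu x hx.1]; exact Real.exp_pos _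
  rw [Real.norm_eq_abs, Real.norm_eq_abs, abs_of_pos h2, ← abs_mul]
  exact h1.trans (le_abs_self _)

/-- If `y = -dt + O(1)`, then `(y-t)γ = -γ(1+d)t + O(1)`; the case `d = 0` is slow decay. -/
theorem isTheta_of_log_bound
    (hu : ∀ x, x ≠ 0 → u x = Real.exp ((y (Real.log ‖x‖) - Real.log ‖x‖) * γ)) (hγ : 0 ≤ γ)
    {d K T : ℝ} (h : ∀ t, T ≤ t → |y t + d * t| ≤ K) :
    u =Θ[Bornology.cobounded E] fun x => ‖x‖ ^ (-(γ * (1 + d))) := by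
  have hb : ∀ t, T ≤ t → |(y t - t) * γ - t * (-(γ * (1 + d)))| ≤ K * γ := fun t ht => by
    rw [show (y t - t) * γ - t * (-(γ * (1 + d))) = (y t + d * t) * γ by ring, abs_mul,
      abs_of_nonneg hγ]
    exact mul_le_mul_of_nonneg_right (h t ht) hγ
  have hG : ∀ t, Real.exp t ^ (-(γ * (1 + d))) = Real.exp (t * (-(γ * (1 + d)))) := fun t =>
    (Real.exp_mul _ _).symm
  constructor
  · refine isBigO_of_log_bound hu (G := fun r => r ^ (-(γ * (1 + d)))) (K := Real.exp (K * γ))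
      (T := T) fun t ht => ?_
    simp only [hG]
    rw [← Real.exp_add, Real.exp_le_exp]
    linarith [(abs_le.1 (hb t ht)).2]
  · refine IsBigO.of_bound (Real.exp (K * γ)) ?_
    filter_upwards [eventually_cobounded_log T] with x hx
    have h1 := hG (Real.log ‖x‖)
    rw [Real.exp_log (norm_pos_iff.2 hx.1)] at h1
    rw [h1, hu x hx.1, Real.norm_eq_abs, Real.norm_eq_abs, Real.abs_exp, Real.abs_exp,
      ← Real.exp_add, Real.exp_le_exp]
    linarith [(abs_le.1 (hb _ hx.2)).1]

end Asymptotics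

end KYamabe

/-! ### The decay theorem -/

theorem theorem1p3 (n k : ℕ) (hn : 3 ≤ n) (hk : 1 ≤ k) (hnk : 2 * k ≤ n)
    (θ ρ : ℝ) (hθ : 0 < θ) (hθρ : 0 < 2 * θ + ρ)
    (m : ℝ) (hm : m = ((n : ℝ) - 2 * k) / (n + 2 * k))
    (α : ℝ) (hα : 0 < α)
    (u : EuclideanSpace ℝ (Fin n) → ℝ) (hu : KYamabe.IsRadialSoliton k θ ρ u) (hu0 : u 0 = α) :
    -- expanders
    (ρ < 0 →
      u =O[Bornology.cobounded _] fun x => ‖x‖ ^ (-(2 / (1 - m)) - ρ / (θ * (1 - m)))) ∧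
    -- steady solitons
    (ρ = 0 → 2 * k < n →
      u =O[Bornology.cobounded _] fun x => (Real.log ‖x‖ / ‖x‖ ^ 2) ^ (1 / (1 - m))) ∧
    (ρ = 0 → n = 2 * k →
      u =O[Bornology.cobounded _] fun x => Real.log ‖x‖ ^ (1 - 2 / (n : ℝ)) / ‖x‖ ^ 2) ∧
    -- shrinkers
    (0 < ρ → ρ ≤ 2 * θ → 2 * k < n →
      u =Θ[Bornology.cobounded _] fun x => ‖x‖ ^ (-(2 / (1 - m)))) ∧
    (2 * θ < ρ → 2 * k < n →
      (u =Θ[Bornology.cobounded _] fun x => ‖x‖ ^ (-(2 / (1 - m)))) ∨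
      (u =Θ[Bornology.cobounded _] fun x => ‖x‖ ^ (-(4 / (1 - m))))) ∧
    (0 < ρ → n = 2 * k →
      ∃ d : ℝ, 0 < d ∧ d ≤ min (ρ / (2 * θ)) 1 ∧
        u =Θ[Bornology.cobounded _] fun x => ‖x‖ ^ (-(2 * (1 + d)))) := by
  have hk0 : (0 : ℝ) < k := by exact_mod_cast hk
  have hn0 : (0 : ℝ) < n := by exact_mod_cast (by omega : 0 < n)
  obtain ⟨D, y, q, q', h, hux⟩ := hu.exists_cylindricalSoliton hn hk hnk hθ
  have hm1 : 1 - m = 4 * k / (n + 2 * k) := by rw [hm]; field_simp; ring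
  obtain ⟨γ, hγ⟩ : ∃ γ : ℝ, γ = (n + 2 * k) / (2 * k) := ⟨_, rfl⟩
  have hγ0 : 0 < γ := by rw [hγ]; positivity
  have e1 : 2 / (1 - m) = γ := by rw [hm1, hγ]; field_simp; norm_num
  have e2 : 1 / (1 - m) = γ / 2 := by rw [← e1]; ring
  have e3 : ρ / (θ * (1 - m)) = ρ / (2 * θ) * γ := by rw [← e1]; field_simp
  have hcrit : n = 2 * k → γ = 2 := fun hn2 => by
    rw [hγ, hn2]; push_cast; field_simp; norm_num
  rw [← hγ] at hux
  -- Slow decay holds for all `ρ > 0` when `n > 2k`; it settles both shrinker cases, and the fast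
  -- alternative is never needed.
  have hslow : 0 < ρ → 2 * k < n →
      u =Θ[Bornology.cobounded _] fun x => ‖x‖ ^ (-(2 / (1 - m))) := by
    intro hρ hlt
    obtain ⟨K, hK⟩ := h.shrinker_bound hρ hlt
    have := KYamabe.isTheta_of_log_bound hux hγ0.le (d := 0) (K := K) (T := 0)
      (fun t ht => by simpa using hK t ht)
    simpa [e1] using this
  refine ⟨fun hρ => ?_, fun hρ _ => ?_, fun hρ hn2 => ?_, fun hρ _ hlt => hslow hρ hlt,
    fun hρ hlt => Or.inl (hslow (by linarith) hlt), fun hρ hn2 => ?_⟩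
  · obtain ⟨K, T, hK⟩ := h.expander_bound hρ
    rw [e1, e3]
    refine KYamabe.isBigO_of_log_bound hux (G := fun r => r ^ (-γ - ρ / (2 * θ) * γ))
      (K := Real.exp (K * γ)) (T := T) fun t ht => ?_
    rw [← Real.exp_mul, ← Real.exp_add, Real.exp_le_exp]
    linarith [mul_le_mul_of_nonneg_right (hK t ht) hγ0.le]
  · subst hρ
    obtain ⟨K, hK⟩ := h.steady_bound
    have hK0 : 0 < K := by simpa using (Real.exp_pos _).trans_le (hK 1 le_rfl)
    rw [e2]
    refine KYamabe.isBigO_of_log_bound hux (G := fun r => (Real.log r / r ^ 2) ^ (γ / 2))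
      (K := K ^ (γ / 2)) (T := 1) fun t ht => ?_
    simp only [Real.log_exp]
    rw [← Real.mul_rpow hK0.le (by positivity), ← mul_div_assoc]
    have : Real.exp ((y t - t) * γ) = (Real.exp (2 * y t) / Real.exp t ^ 2) ^ (γ / 2) := by
      rw [← Real.exp_nat_mul, ← Real.exp_sub, ← Real.exp_mul]
      congr 1
      push_cast
      ring
    rw [this]
    exact Real.rpow_le_rpow (by positivity)
      (div_le_div_of_nonneg_right (hK t ht) (by positivity)) (by positivity)
  · subst hρ
    obtain ⟨K, hK⟩ := h.steady_bound_of_eq hn2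
    have hexp : 1 - 2 / (n : ℝ) = 1 - 1 / (k : ℝ) := by rw [hn2]; push_cast; field_simp
    rw [hexp]
    refine KYamabe.isBigO_of_log_bound hux
      (G := fun r => Real.log r ^ (1 - 1 / (k : ℝ)) / r ^ 2) (K := K) (T := 1) fun t ht => ?_
    simp only [Real.log_exp]
    have : Real.exp ((y t - t) * γ) = Real.exp (2 * y t) / Real.exp t ^ 2 := by
      rw [hcrit hn2, ← Real.exp_nat_mul, ← Real.exp_sub]
      congr 1
      push_cast
      ring
    rw [this, ← mul_div_assoc]
    exact div_le_div_of_nonneg_right (hK t ht) (by positivity)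
  · obtain ⟨d, hd0, hd1, K, T, hK⟩ := h.critical_shrinker_bound hρ hn2
    refine ⟨d, hd0, hd1, ?_⟩
    have := KYamabe.isTheta_of_log_bound hux hγ0.le hK
    rwa [hcrit hn2] at this
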